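/- Let $p,q\ge 1$ be integers, let $\mathbf A=(A_1,\dots,A_p)$ and $\mathbf B=(B_1,\dots,B_q)$ be vectors with positive entries, and assume $$\Delta=\sum_{j=1}^q B_j-\sum_{k=1}^p A_k=0 .$$ Put $\rho=\prod_{k=1}^p A_k^{A_k}\prod_{j=1}^q B_j^{-B_j}$. For $\mathbf a\in\mathbb R^p$, $\mathbf b\in\mathbb R^q$ put $$\mu=\mu(\mathbf a,\mathbf b)=\sum_{j=1}^q b_j-\sum_{k=1}^p a_k+\frac{p-q}{2},$$ and for $0<x<\rho$ let $$H(x\,|\,\mathbf a,\mathbf b)=\frac{1}{2\pi i}\int_{\mathcal L}\frac{\prod_{k=1}^p\Gamma(A_ks+a_k)}{\prod_{j=1}^q\Gamma(B_js+b_j)}\,x^{-s}\,ds$$ be the delta neutral Fox function $H^{p,0}_{q,p}$, where $\mathcal L$ is a left loop, lying in a horizontal strip, that starts at $-\infty+i\varphi_1$, ends at $-\infty+i\varphi_2$ ($\varphi_1<0<\varphi_2$) and leaves all the poles of the integrand on its left. Let $S=\{(\mathbf a,\mathbf b)\in\mathbb R^{p+q}:\ a_k\ge 0 \text{ for all } k,\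 \mu(\mathbf a,\mathbf b)>0\}$, and let $(\mathbf a^*,\mathbf b^*)\in\mathbb R^{p+q}$ satisfy $a_k^*\ge 0$ for all $k$ and $\mu(\mathbf a^*,\mathbf b^*)=0$ (so that it is a limit point of $S$). Put $$\nu^*=(2\pi)^{(p-q)/2}\prod_{k=1}^p A_k^{a_k^*-1/2}\prod_{j=1}^q B_j^{1/2-b_j^*}.$$ Then $H(\cdot\,|\,\mathbf a,\mathbf b)$, for every $(\mathbf a,\mathbf b)\in S$, and $H(\cdot\,|\,\mathbf a^*,\mathbf b^*)$ are integrable on $[0,\rho]$, and for every $0\le\eta<\rho$ the signed measures $H(x\,|\,\mathbf a,\mathbf b)\,dx$ converge weakly on $[\eta,\rho]$ to the signed measure $$\nu^*\rho\,\delta_\rho+H(x\,|\,\mathbf a^*,\mathbf b^*)\,dx$$ as $S\ni(\mathbf a,\mathbf b)\to(\mathbf a^*,\mathbf b^*)$; that is, the integrals over $[\eta,\rho]$ of every function continuous on $[\eta,\rho]$ converge. In particular, for every $f$ continuous on $[\eta,\rho]$, $$\int_\eta^\rho f(x)H(x\,|\,\mathbf a^*,\mathbf b^*)\,dx=\lim_{S\ni(\mathbf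 a,\mathbf b)\to(\mathbf a^*,\mathbf b^*)}\int_\eta^\rho f(x)H(x\,|\,\mathbf a,\mathbf b)\,dx-\nu^*\rho f(\rho).$$ -/

import Mathlib

noncomputable section

namespace FoxH

variable {p q : ℕ}

/-- The gamma ratio `∏ₖ Γ(Aₖ s + aₖ) / ∏ⱼ Γ(Bⱼ s + bⱼ)`. Since `Complex.Gamma` and division take the
value `0` at a pole and at a zero divisor, the factor `1 / Γ` has its correct value `0` at the poles
of `Γ`. -/
def gammaRatio (A a : Fin p → ℝ) (B b : Fin q → ℝ) (s : ℂ) : ℂ :=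
  (∏ k, Complex.Gamma (A k * s + a k)) / ∏ j, Complex.Gamma (B j * s + b j)

/-- The Mellin-Barnes integrand `∏ₖ Γ(Aₖ s + aₖ) / ∏ⱼ Γ(Bⱼ s + bⱼ) * x ^ (-s)`. -/
def integrand (A a : Fin p → ℝ) (B b : Fin q → ℝ) (x : ℝ) (s : ℂ) : ℂ :=
  gammaRatio A a B b s * (x : ℂ) ^ (-s)

/-- The integral of `F` along the left loop `-∞ + i φ₁ → c + i φ₁ → c + i φ₂ → -∞ + i φ₂`. -/
def leftLoopIntegral (F : ℂ → ℂ) (φ₁ φ₂ c : ℝ) : ℂ :=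
  (∫ u in Set.Iic c, F (u + φ₁ * Complex.I))
    + Complex.I * (∫ t in φ₁..φ₂, F (c + t * Complex.I))
    - ∫ u in Set.Iic c, F (u + φ₂ * Complex.I)

/-- A real abscissa to the right of all the points `-aₖ / Aₖ`, hence of all the poles
`-(aₖ + n) / Aₖ` of the gamma ratio, which are real. -/
def abscissa (A a : Fin p → ℝ) : ℝ := 1 + ∑ k, |a k| / A k

/-- Complex value of the delta neutral `H^{p,0}_{q,p}(x | (B, b); (A, a))` for `0 < x < ρ`: the
integral of the Mellin-Barnes integrand over a left loop that encloses all its poles,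
divided by `2πi`. (The value does not depend on the choice of the loop.) -/
def foxHComplex (A a : Fin p → ℝ) (B b : Fin q → ℝ) (x : ℝ) : ℂ :=
  (2 * Real.pi * Complex.I)⁻¹ *
    leftLoopIntegral (integrand A a B b x) (-1) 1 (abscissa A a)

/-- The delta neutral Fox function `H^{p,0}_{q,p}(x | (B, b); (A, a))` for `0 < x < ρ`, as a real
number; see `foxHComplex_eq_ofReal`. -/
def foxH (A a : Fin p → ℝ) (B b : Fin q → ℝ) (x : ℝ) : ℝ :=
  (foxHComplex A a B b x).re

lemma integrand_conj (A a : Fin p → ℝ) (B b : Fin q → ℝ) {x : ℝ} (hx : 0 < x) (s : ℂ) :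
    integrand A a B b x (starRingEnd ℂ s) = starRingEnd ℂ (integrand A a B b x s) := by
  have h1 : ∀ (α β : ℝ), Complex.Gamma (α * starRingEnd ℂ s + β)
      = starRingEnd ℂ (Complex.Gamma (α * s + β)) := by
    intro α β
    rw [← Complex.Gamma_conj]
    simp
  have h2 : (x : ℂ) ^ (-(starRingEnd ℂ s)) = starRingEnd ℂ ((x : ℂ) ^ (-s)) := by
    rw [← map_neg, Complex.cpow_conj, Complex.conj_ofReal]
    rw [Complex.arg_ofReal_of_nonneg hx.le]
    exact Real.pi_ne_zero.symm
  simp only [integrand, gammaRatio, map_mul, map_div₀, map_prod, h1, h2]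

/-- The contour integral is real, so that passing to `foxH` loses nothing. -/
theorem foxHComplex_eq_ofReal (A a : Fin p → ℝ) (B b : Fin q → ℝ) {x : ℝ} (hx : 0 < x) :
    foxHComplex A a B b x = (foxH A a B b x : ℂ) := by
  refine (Complex.conj_eq_iff_re.mp ?_).symm
  have hc : ∀ s, starRingEnd ℂ (integrand A a B b x s)
      = integrand A a B b x (starRingEnd ℂ s) := fun s => (integrand_conj A a B b hx s).symm
  unfold foxHComplex leftLoopIntegral
  generalize abscissa A a = c
  generalize integrand A a B b x = F at hc ⊢
  have h1 : ∀ φ : ℝ, starRingEnd ℂ (∫ u in Set.Iic c, F (u + φ * Complex.I))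
      = ∫ u in Set.Iic c, F (u + ((-φ : ℝ) : ℂ) * Complex.I) := by
    intro φ
    rw [← integral_conj]
    refine MeasureTheory.integral_congr_ae (Filter.Eventually.of_forall fun u => ?_)
    simp [hc]
  have h2 : starRingEnd ℂ (∫ t in (-1 : ℝ)..1, F (c + t * Complex.I))
      = ∫ t in (-1 : ℝ)..1, F (c + t * Complex.I) := by
    have h3 : starRingEnd ℂ (∫ t in (-1 : ℝ)..1, F (c + t * Complex.I))
        = ∫ t in (-1 : ℝ)..1, F (c + ((-t : ℝ) : ℂ) * Complex.I) := by
      rw [← intervalIntegral.intervalIntegral_conj]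
      refine intervalIntegral.integral_congr fun t _ => ?_
      simp [hc]
    rw [h3, intervalIntegral.integral_comp_neg (fun t : ℝ => F (c + t * Complex.I))]
    simp
  have h4 := h1 (-1)
  have h5 := h1 1
  rw [neg_neg] at h4
  simp only [map_mul, map_inv₀, map_add, map_sub, h4, h5, h2,
    Complex.conj_I, Complex.conj_ofReal, map_ofNat]
  simp only [mul_neg, inv_neg]
  ring

/-- `Δ = ∑ⱼ Bⱼ - ∑ₖ Aₖ`. -/
def Delta (A : Fin p → ℝ) (B : Fin q → ℝ) : ℝ := ∑ j, B j - ∑ k, A k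

/-- `ρ = ∏ₖ Aₖ ^ Aₖ * ∏ⱼ Bⱼ ^ (-Bⱼ)`. -/
def rho (A : Fin p → ℝ) (B : Fin q → ℝ) : ℝ := (∏ k, A k ^ A k) * ∏ j, B j ^ (-B j)

/-- `μ = ∑ⱼ bⱼ - ∑ₖ aₖ + (p - q) / 2`. -/
def mu (a : Fin p → ℝ) (b : Fin q → ℝ) : ℝ := ∑ j, b j - ∑ k, a k + ((p : ℝ) - q) / 2

/-- `ν = (2π) ^ ((p - q) / 2) * ∏ₖ Aₖ ^ (aₖ - 1/2) * ∏ⱼ Bⱼ ^ (1/2 - bⱼ)`. -/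
def nu (A a : Fin p → ℝ) (B b : Fin q → ℝ) : ℝ :=
  (2 * Real.pi) ^ (((p : ℝ) - q) / 2) * (∏ k, A k ^ (a k - 1 / 2)) * ∏ j, B j ^ (1 / 2 - b j)

/-- The parameter set `S = {(a, b) : a ≥ 0, μ > 0}` in `ℝ^p × ℝ^q`. -/
def paramSet (p q : ℕ) : Set ((Fin p → ℝ) × (Fin q → ℝ)) :=
  {P | (∀ k, 0 ≤ P.1 k) ∧ 0 < mu P.1 P.2}

/-- The signed measure `H(x | a, b) dx` on `[0, ρ]`. -/
def foxMeasure (A a : Fin p → ℝ) (B b : Fin q → ℝ) : MeasureTheory.SignedMeasure ℝ :=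
  (MeasureTheory.volume.restrict (Set.Icc 0 (rho A B))).withDensityᵥ (foxH A a B b)

/-- The signed measure `ν ρ δ_ρ + H(x | a, b) dx` on `[0, ρ]`. -/
def limitMeasure (A a : Fin p → ℝ) (B b : Fin q → ℝ) : MeasureTheory.SignedMeasure ℝ :=
  MeasureTheory.VectorMeasure.dirac (rho A B) (nu A a B b * rho A B) + foxMeasure A a B b

/-- Weak convergence on `[α, β]` of the (restrictions to `[α, β]` of the) signed measures `m i` to
`m₀` along the filter `l`: convergence of the integrals over `[α, β]` of every function that is
continuous on `[α, β]`. -/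
def WeakConvergesOn {ι : Type*} (m : ι → MeasureTheory.SignedMeasure ℝ) (l : Filter ι)
    (m₀ : MeasureTheory.SignedMeasure ℝ) (α β : ℝ) : Prop :=
  ∀ f : ℝ → ℝ, ContinuousOn f (Set.Icc α β) →
    Filter.Tendsto
      (fun i => ((m i).restrict (Set.Icc α β)).integral f (ContinuousLinearMap.lsmul ℝ ℝ)) l
      (nhds ((m₀.restrict (Set.Icc α β)).integral f (ContinuousLinearMap.lsmul ℝ ℝ)))

end FoxH

end

open Filter Topology MeasureTheory Complex

namespace FoxH

variable {p q : ℕ}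

/-! Substitute x = ρ e^{-t} with t > 0, so that x → ρ corresponds to t → 0. The integrand becomes
`normRatio` times e^{tw}, where `normRatio` is the gamma ratio divided by ρ^w. When Δ = 0,
Stirling's formula (`exists_Gamma_eq_stirling`, `exists_normRatio_eq`) gives `normRatio` = ν w^{-μ}
e^E away from the negative axis, with E = O(1/R) on the part of the plane at level R, uniformly for
bounded parameters.

The loop integral of w^{-μ} e^{tw} equals t^{μ-1} h(μ), where h is `hankel` (classically 1/Γ). Hence
H = ν h(μ) t^{μ-1} + remainder. The remainder is bounded uniformly in the parameters by C e^{t/2}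
(`exists_abs_foxH_sub_le`). For small t, a loop of size 1/t is used: the relative error there is
O(t) and the effective length of the loop is O(1/t). For large t, a fixed loop with right side at
1/2 is enough.

The recurrence h(μ) = μ h(μ+1) turns the main term into ν h(μ+1) · μ t^{μ-1}. The kernel μ t^{μ-1}
is an approximate identity at t = 0 as μ → 0+ (`tendsto_integral_mul_rpow_sub_one`), and h(μ+1) →
h(1) = 1. The main term therefore contributes ν* times the value at t = 0, and the Jacobian ρ e^{-t}
supplies the factor ρ of the point mass. For fixed t > 0 the main term tends to 0, so the remainder
tends pointwise to H at the limit parameters. The Jacobian beats e^{t/2}, and dominated convergence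
applies (`tendsto_integral_mul_foxH`). Of h only the recurrence, the value at 1, its right
continuity there and a uniform bound are needed. -/

/-! ### Stirling's formula for the complex gamma function -/

/-- The points whose real part or whose distance from the real axis is at least `R`. -/
def farRegion (R : ℝ) : Set ℂ := {z | R ≤ z.re ∨ R ≤ |z.im|}

lemma mem_slitPlane_of_mem_farRegion {R : ℝ} (hR : 0 < R) {z : ℂ} (hz : z ∈ farRegion R) :
    z ∈ Complex.slitPlane := by
  rcases hz with h | h
  · exact Or.inl (hR.trans_le h)
  · exact Or.inr (abs_pos.mp (hR.trans_le h))

lemma le_norm_of_mem_farRegion {R : ℝ} {z : ℂ} (hz : z ∈ farRegion R) : R ≤ ‖z‖ := by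
  rcases hz with h | h
  · exact h.trans (Complex.re_le_norm z)
  · exact h.trans (Complex.abs_im_le_norm z)

lemma add_ofReal_mem_farRegion {R : ℝ} {z : ℂ} (hz : z ∈ farRegion R) {u : ℝ} (hu : 0 ≤ u) :
    z + u ∈ farRegion R := by
  rcases hz with h | h
  · left; simp; linarith
  · right; simpa using h

/-- The increment `(z + 1/2) (log (z + 1) - log z) - 1` in Stirling's formula. -/
noncomputable def stirlingStep (z : ℂ) : ℂ := (z + 1 / 2) * (Complex.log (z + 1) - Complex.log z) - 1

/-- The main part `(z - 1/2) log z - z` of the logarithm of the gamma function. -/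
noncomputable def stirlingMain (z : ℂ) : ℂ := (z - 1 / 2) * Complex.log z - z

lemma stirlingMain_add_one (z : ℂ) :
    stirlingMain (z + 1) = stirlingMain z + Complex.log z + stirlingStep z := by
  unfold stirlingMain stirlingStep; ring

/-- Integration by parts turns the step into the integral over [0, 1] of u(1-u)/2 · (z+u)^{-2}, and
u(1-u)/2 ≤ 1/8. The comparison function `b` is left free so that the two kinds of far points can use
different antiderivatives. -/
lemma norm_stirlingStep_le {z : ℂ} (hz : ∀ u : ℝ, 0 ≤ u → z + u ∈ Complex.slitPlane)
    {b b' : ℝ → ℝ} (hb : ∀ u, 0 ≤ u → HasDerivAt b (b' u) u)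
    (hbb : ∀ u : ℝ, 0 ≤ u → (‖z + u‖ ^ 2)⁻¹ ≤ 8 * b' u) :
    ‖stirlingStep z‖ ≤ b 1 - b 0 := by
  let f : ℝ → ℂ := fun u => (z + 1 / 2) * (Complex.log (z + u) - Complex.log z) - u
    - (u * (1 - u) / 2) / (z + u)
  have hf : ∀ u : ℝ, 0 ≤ u → HasDerivAt f ((u * (1 - u) / 2) / (z + u) ^ 2) u := by
    intro u hu
    have hne : z + u ≠ 0 := Complex.slitPlane_ne_zero (hz u hu)
    have h0 : HasDerivAt (fun u : ℝ => (u : ℂ)) 1 u := Complex.ofRealCLM.hasDerivAt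
    have h1 : HasDerivAt (fun u : ℝ => z + (u : ℂ)) 1 u := h0.const_add z
    have h2 : HasDerivAt (fun u : ℝ => Complex.log (z + u)) (1 / (z + u)) u :=
      h1.clog_real (hz u hu)
    have h3 : HasDerivAt (fun u : ℝ => ((u : ℂ) * (1 - u) / 2)) ((1 * (1 - u) + u * (-1)) / 2) u :=
      (h0.mul (h0.const_sub 1)).div_const 2
    have h4 := (((h2.sub_const (Complex.log z)).const_mul (z + 1 / 2)).sub h0).sub (h3.div h1 hne)
    refine h4.congr_deriv ?_
    field_simp
    ring
  have key := image_norm_le_of_norm_deriv_right_le_deriv_boundary' (a := 0) (b := 1) (f := f)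
    (f' := fun u => ((u * (1 - u) / 2) / (z + u) ^ 2)) (B := fun u => b u - b 0) (B' := b')
    (fun u hu => (hf u hu.1).continuousAt.continuousWithinAt)
    (fun u hu => (hf u hu.1).hasDerivWithinAt) (by simp [f])
    (fun u hu => ((hb u hu.1).sub_const _).continuousAt.continuousWithinAt)
    (fun u hu => ((hb u hu.1).sub_const _).hasDerivWithinAt) (fun u hu => by
      have h1 : ‖((u : ℂ) * (1 - u) / 2)‖ ≤ 1 / 8 := by
        rw [show ((u : ℂ) * (1 - u) / 2) = ((u * (1 - u) / 2 : ℝ) : ℂ) by push_cast; ring,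
          Complex.norm_real, Real.norm_eq_abs, abs_of_nonneg]
        · nlinarith [sq_nonneg (u - 1 / 2)]
        · have := hu.1; have := hu.2; nlinarith
      rw [norm_div, norm_pow, div_eq_mul_inv]
      have h2 := hbb u hu.1
      have h3 : 0 ≤ (‖z + u‖ ^ 2)⁻¹ := by positivity
      calc _ ≤ 1 / 8 * (‖z + u‖ ^ 2)⁻¹ := by gcongr
        _ ≤ _ := by linarith) (x := 1) (by simp)
  have h1 : f 1 = stirlingStep z := by simp [f, stirlingStep]
  simpa [h1] using key

/-- The step bounds telescope to the total increment of one function b, which is bounded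
independently of n: -1/(8(Re z + u)) when Re z is large, and an arctangent with total variation
π/(8|Im z|) when |Im z| is large. -/
lemma norm_sum_stirlingStep_le {R : ℝ} (hR : 0 < R) {z : ℂ} (hz : z ∈ farRegion R) (n : ℕ) :
    ‖∑ m ∈ Finset.range n, stirlingStep (z + m)‖ ≤ 1 / R := by
  have hmem : ∀ u : ℝ, 0 ≤ u → z + u ∈ Complex.slitPlane := fun u hu =>
    mem_slitPlane_of_mem_farRegion hR (add_ofReal_mem_farRegion hz hu)
  obtain ⟨b, b', hb, hbb, hbd⟩ : ∃ b b' : ℝ → ℝ, (∀ u, 0 ≤ u → HasDerivAt b (b' u) u) ∧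
      (∀ u : ℝ, 0 ≤ u → (‖z + u‖ ^ 2)⁻¹ ≤ 8 * b' u) ∧ ∀ n : ℕ, b n - b 0 ≤ 1 / R := by
    have hns : ∀ u : ℝ, ‖z + u‖ ^ 2 = (z.re + u) ^ 2 + z.im ^ 2 := by
      intro u; rw [Complex.sq_norm, Complex.normSq_apply]; simp; ring
    rcases hz with h | h
    · refine ⟨fun u => -(z.re + u)⁻¹ / 8, fun u => ((z.re + u) ^ 2)⁻¹ / 8, fun u hu => ?_,
        fun u hu => ?_, fun n => ?_⟩
      · have hne : z.re + u ≠ 0 := by linarith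
        have := (((hasDerivAt_id u).const_add z.re).inv hne).neg.div_const 8
        refine this.congr_deriv ?_
        simp; field_simp
      · rw [hns]
        have : 0 < z.re + u := by linarith
        rw [mul_div_cancel₀ _ (by norm_num)]
        gcongr
        nlinarith [sq_nonneg z.im]
      · have h1 : 0 < (z.re + n)⁻¹ := inv_pos.mpr (add_pos_of_pos_of_nonneg (hR.trans_le h) n.cast_nonneg)
        have h2 : z.re⁻¹ ≤ 1 / R := by rw [one_div]; gcongr
        have h3 : 0 < 1 / R := by positivity
        simp only [add_zero]
        linarith
    · have hy : 0 < |z.im| := hR.trans_le h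
      refine ⟨fun u => Real.arctan ((z.re + u) / |z.im|) / |z.im| / 8,
        fun u => (1 / (1 + ((z.re + u) / |z.im|) ^ 2) * (1 / |z.im|)) / |z.im| / 8, fun u hu => ?_,
        fun u hu => ?_, fun n => ?_⟩
      · have := ((((hasDerivAt_id u).const_add z.re).div_const |z.im|).arctan.div_const
          |z.im|).div_const 8
        exact this
      · rw [hns, ← sq_abs z.im, mul_div_cancel₀ _ (by norm_num)]
        refine le_of_eq ?_
        field_simp
        ring
      · have h1 := Real.arctan_lt_pi_div_two ((z.re + n) / |z.im|)
        have h2 := Real.neg_pi_div_two_lt_arctan ((z.re + (0 : ℝ)) / |z.im|)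
        have h3 := Real.pi_lt_four
        calc _ = (Real.arctan ((z.re + n) / |z.im|) - Real.arctan ((z.re + (0 : ℝ)) / |z.im|))
              / 8 / |z.im| := by ring
          _ ≤ 1 / |z.im| := by gcongr; linarith
          _ ≤ 1 / R := by gcongr
  refine le_trans ?_ (hbd n)
  have hstep : ∀ m : ℕ, ‖stirlingStep (z + m)‖ ≤ b (m + 1) - b m := by
    intro m
    have := norm_stirlingStep_le (z := z + m) (b := fun u => b (m + u)) (b' := fun u => b' (m + u))
      (fun u hu => by
        have := hmem (m + u) (by positivity)
        push_cast at this
        rwa [← add_assoc] at this)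
      (fun u hu => by
        have := hb (m + u) (by positivity)
        exact this.comp_const_add (m : ℝ) u)
      (fun u hu => by
        have := hbb (m + u) (by positivity)
        push_cast at this
        rwa [← add_assoc] at this)
    simpa using this
  calc _ ≤ ∑ m ∈ Finset.range n, ‖stirlingStep (z + m)‖ := norm_sum_le _ _
    _ ≤ ∑ m ∈ Finset.range n, (b ((m + 1 : ℕ) : ℝ) - b m) :=
        Finset.sum_le_sum fun m _ => by push_cast; exact hstep m
    _ = b n - b 0 := by rw [Finset.sum_range_sub (fun m : ℕ => b m)]; simp

/-- Each log (z+m) is the increment of `stirlingMain` minus a `stirlingStep`, so the product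
telescopes in the exponent. -/
lemma prod_add_natCast_eq_exp {z : ℂ} (hz : ∀ m : ℕ, z + m ≠ 0) (n : ℕ) :
    ∏ j ∈ Finset.range n, (z + j) = Complex.exp (stirlingMain (z + n) - stirlingMain z
      - ∑ m ∈ Finset.range n, stirlingStep (z + m)) := by
  induction n with
  | zero => simp
  | succ n ih =>
    rw [Finset.prod_range_succ, ih, Finset.sum_range_succ, ← Complex.exp_log (hz n),
      ← Complex.exp_add]
    congr 1
    push_cast
    rw [← add_assoc, stirlingMain_add_one (z + n), Complex.exp_log (hz n)]
    ring

/-- This fixes the constant √(2π): what remains of `GammaSeq` after telescoping is governed by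
Stirling's formula for n!. -/
lemma tendsto_natCast_cpow_mul_factorial_mul_exp (z : ℂ) :
    Tendsto (fun n : ℕ => (n : ℂ) ^ z * (n.factorial : ℂ)
      * Complex.exp (-stirlingMain (z + (n + 1 : ℕ)))) atTop (𝓝 (√(2 * Real.pi) : ℝ)) := by
  let δ : ℕ → ℂ := fun n => Complex.log (1 + (z + 1) / n)
  have hinv : Tendsto (fun n : ℕ => (z + 1) / (n : ℂ)) atTop (𝓝 0) :=
    tendsto_const_div_atTop_nhds_zero_nat (z + 1)
  have hδ : Tendsto δ atTop (𝓝 0) := by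
    have h1 : ContinuousAt (fun s : ℂ => Complex.log (1 + s)) 0 := by
      refine ContinuousAt.clog (by fun_prop) (by simp)
    have := h1.tendsto.comp hinv
    simpa [δ, Function.comp_def] using this
  have hnδ : Tendsto (fun n : ℕ => (n : ℂ) * δ n) atTop (𝓝 (z + 1)) := by
    refine Complex.tendsto_nat_mul_log_one_add_of_tendsto (g := fun n : ℕ => (z + 1) / n) ?_
    refine tendsto_const_nhds.congr' ?_
    filter_upwards [eventually_ne_atTop 0] with n hn
    field_simp
  -- Since log (z+n+1) = log n + δ n with δ n → 0 and n δ n → z+1, the exponent tends to 0, and only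
  -- √π · √2 survives.
  have hlim : Tendsto (fun n : ℕ => ((Stirling.stirlingSeq n : ℝ) : ℂ) * ((√2 : ℝ) : ℂ)
      * Complex.exp (z + 1 - (z + 1 / 2) * δ n - n * δ n)) atTop (𝓝 (√(2 * Real.pi) : ℝ)) := by
    have h1 : Tendsto (fun n : ℕ => ((Stirling.stirlingSeq n : ℝ) : ℂ)) atTop
        (𝓝 ((√Real.pi : ℝ) : ℂ)) :=
      (Complex.continuous_ofReal.tendsto _).comp Stirling.tendsto_stirlingSeq_sqrt_pi
    have h2 : Tendsto (fun n : ℕ => z + 1 - (z + 1 / 2) * δ n - n * δ n) atTop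
        (𝓝 (z + 1 - (z + 1 / 2) * 0 - (z + 1))) :=
      ((tendsto_const_nhds (x := z + 1)).sub (hδ.const_mul (z + 1 / 2))).sub hnδ
    have h3 := (h1.mul_const ((√2 : ℝ) : ℂ)).mul ((Complex.continuous_exp.tendsto _).comp h2)
    convert! h3 using 2
    rw [mul_comm 2 Real.pi, Real.sqrt_mul Real.pi_pos.le]
    push_cast
    simp
  refine hlim.congr' ?_
  have hne : ∀ᶠ n : ℕ in atTop, 1 + (z + 1) / (n : ℂ) ≠ 0 := by
    have : Tendsto (fun n : ℕ => 1 + (z + 1) / (n : ℂ)) atTop (𝓝 (1 + 0)) := hinv.const_add 1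
    exact this.eventually_ne (by simp)
  filter_upwards [eventually_gt_atTop 0, hne] with n hn hn1
  have hn0 : (0 : ℝ) < n := by exact_mod_cast hn
  have hnc : (n : ℂ) ≠ 0 := by exact_mod_cast hn.ne'
  set l : ℂ := ((Real.log n : ℝ) : ℂ) with hl
  have hlog : Complex.log (n : ℂ) = l := by
    rw [hl, Complex.ofReal_log hn0.le]; simp
  have e1 : (n : ℂ) ^ z = Complex.exp (l * z) := by
    rw [Complex.cpow_def_of_ne_zero hnc, hlog]
  have e2 : ((n.factorial : ℝ)) = Stirling.stirlingSeq n * (√2 * (√n * (n / Real.exp 1) ^ n)) := by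
    unfold Stirling.stirlingSeq
    rw [Real.sqrt_mul (by norm_num)]
    field_simp
  have e3 : ((√n * (n / Real.exp 1) ^ n : ℝ) : ℂ) = Complex.exp (l / 2 + n * l - n) := by
    rw [hl]
    rw [show (((Real.log n : ℝ) : ℂ) / 2 + n * ((Real.log n : ℝ) : ℂ) - n)
      = ((Real.log n / 2 + n * Real.log n - n : ℝ) : ℂ) by push_cast; ring, ← Complex.ofReal_exp]
    congr 1
    rw [Real.exp_sub, Real.exp_add, Real.exp_nat_mul, Real.exp_log hn0, div_pow, ← Real.exp_nat_mul,
      mul_one, Real.sqrt_eq_rpow, Real.rpow_def_of_pos hn0]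
    ring_nf
  have e4 : (n.factorial : ℂ) = ((Stirling.stirlingSeq n : ℝ) : ℂ) * ((√2 : ℝ) : ℂ)
      * Complex.exp (l / 2 + n * l - n) := by
    rw [← e3]
    have := congrArg (fun r : ℝ => (r : ℂ)) e2
    push_cast at this ⊢
    rw [this]; ring
  have e5 : Complex.log (z + (n + 1 : ℕ)) = l + δ n := by
    have : z + (n + 1 : ℕ) = ((n : ℝ) : ℂ) * (1 + (z + 1) / n) := by
      push_cast; field_simp; ring
    rw [this, Complex.log_ofReal_mul hn0 hn1]
  rw [e1, e4, stirlingMain, e5]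
  rw [mul_left_comm, mul_assoc (_ * _), ← Complex.exp_add, ← Complex.exp_add]
  congr 2
  push_cast
  ring

/-- Stirling's formula for the gamma function away from the negative real axis, with an error
term that is uniform over half-planes. -/
theorem exists_Gamma_eq_stirling {R : ℝ} (hR : 0 < R) {z : ℂ} (hz : z ∈ farRegion R) :
    ∃ J : ℂ, ‖J‖ ≤ 1 / R ∧
      Complex.Gamma z = (√(2 * Real.pi) : ℝ) * Complex.exp (stirlingMain z + J) := by
  let J : ℕ → ℂ := fun n => ∑ m ∈ Finset.range (n + 1), stirlingStep (z + m)
  have hJ : ∀ n, J n ∈ Metric.closedBall (0 : ℂ) (1 / R) := fun n => by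
    simpa using norm_sum_stirlingStep_le hR hz (n + 1)
  -- The limit of `GammaSeq` is already known, so a limit point of the bounded sums is enough;
  -- convergence of the series of steps is not required.
  obtain ⟨J₀, hJ₀, φ, hφ, hlim⟩ := (isCompact_closedBall (0 : ℂ) (1 / R)).tendsto_subseq hJ
  refine ⟨J₀, by simpa using hJ₀, ?_⟩
  have hne : ∀ m : ℕ, z + m ≠ 0 := fun m => Complex.slitPlane_ne_zero
    (mem_slitPlane_of_mem_farRegion hR (by
      simpa using add_ofReal_mem_farRegion hz (u := m) (by positivity)))
  have hseq : ∀ n, Complex.GammaSeq z n = ((n : ℂ) ^ z * (n.factorial : ℂ)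
      * Complex.exp (-stirlingMain (z + (n + 1 : ℕ)))) * Complex.exp (stirlingMain z + J n) := by
    intro n
    unfold Complex.GammaSeq
    rw [prod_add_natCast_eq_exp hne, div_eq_mul_inv, ← Complex.exp_neg, mul_assoc _ (Complex.exp _),
      ← Complex.exp_add]
    congr 2
    simp only [J]
    ring
  have h1 := (Complex.GammaSeq_tendsto_Gamma z).comp hφ.tendsto_atTop
  have h2 := (tendsto_natCast_cpow_mul_factorial_mul_exp z).comp hφ.tendsto_atTop
  have h3 : Tendsto (fun n => Complex.exp (stirlingMain z + J (φ n))) atTop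
      (𝓝 (Complex.exp (stirlingMain z + J₀))) :=
    (Complex.continuous_exp.tendsto _).comp (hlim.const_add _)
  refine tendsto_nhds_unique h1 ((h2.mul h3).congr fun n => ?_)
  simp only [Function.comp_apply]
  rw [hseq]

/-! ### Asymptotics of the gamma ratio -/

lemma norm_log_add_sub_log_le {w γ : ℂ} {r : ℝ} (hr : 0 < r)
    (hs : ∀ v : ℝ, 0 ≤ v → v ≤ 1 → w + v * γ ∈ Complex.slitPlane)
    (hn : ∀ v : ℝ, 0 ≤ v → v ≤ 1 → r ≤ ‖w + v * γ‖) {v : ℝ} (hv : v ∈ Set.Icc (0 : ℝ) 1) :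
    ‖Complex.log (w + v * γ) - Complex.log w‖ ≤ ‖γ‖ / r := by
  have key := norm_image_sub_le_of_norm_deriv_le_segment' (a := 0) (b := 1) (C := ‖γ‖ / r)
    (f := fun v : ℝ => Complex.log (w + v * γ)) (f' := fun v : ℝ => (1 * γ) / (w + v * γ))
    (fun x hx => by
      have h0 : HasDerivAt (fun u : ℝ => (u : ℂ)) 1 x := Complex.ofRealCLM.hasDerivAt
      exact (((h0.mul_const γ).const_add w).clog_real (hs x hx.1 hx.2)).hasDerivWithinAt)
    (fun x hx => by
      rw [one_mul, norm_div]
      gcongr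
      exact hn x hx.1 hx.2.le) v hv
  simp only [Complex.ofReal_zero, zero_mul, add_zero, sub_zero] at key
  refine key.trans (mul_le_of_le_one_right (by positivity) hv.2)

/-- Along the segment the derivative is γ times a difference of logarithms: subtracting vγ removes
the first-order term, so the bound is quadratic in γ. -/
lemma norm_add_mul_log_sub_sub_le {w γ : ℂ} {r : ℝ} (hr : 0 < r)
    (hs : ∀ v : ℝ, 0 ≤ v → v ≤ 1 → w + v * γ ∈ Complex.slitPlane)
    (hn : ∀ v : ℝ, 0 ≤ v → v ≤ 1 → r ≤ ‖w + v * γ‖) :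
    ‖(w + γ) * (Complex.log (w + γ) - Complex.log w) - γ‖ ≤ ‖γ‖ ^ 2 / r := by
  have key := norm_image_sub_le_of_norm_deriv_le_segment' (a := 0) (b := 1) (C := ‖γ‖ ^ 2 / r)
    (f := fun v : ℝ => (w + v * γ) * (Complex.log (w + v * γ) - Complex.log w) - v * γ)
    (f' := fun v : ℝ => γ * (Complex.log (w + v * γ) - Complex.log w))
    (fun x hx => by
      have h0 : HasDerivAt (fun u : ℝ => (u : ℂ)) 1 x := Complex.ofRealCLM.hasDerivAt
      have h1 := (h0.mul_const γ).const_add w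
      have h2 := ((h1.mul ((h1.clog_real (hs x hx.1 hx.2)).sub_const (Complex.log w))).sub
        (h0.mul_const γ))
      refine (h2.congr_deriv ?_).hasDerivWithinAt
      have hne := Complex.slitPlane_ne_zero (hs x hx.1 hx.2)
      rw [mul_div_cancel₀ _ hne]
      ring)
    (fun x hx => by
      rw [norm_mul, sq, mul_div_assoc]
      gcongr
      exact norm_log_add_sub_log_le hr hs hn ⟨hx.1, hx.2.le⟩) 1 (by simp)
  simpa using key

/-- Stirling's formula for `Γ(α w + β)` in terms of `log w`, uniform for bounded `β`. -/
lemma exists_Gamma_mul_add_eq_exp {α β M R : ℝ} (hα : 0 < α) (hβ : |β| ≤ M) (hR : 0 < R) {w : ℂ}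
    (hw : R ≤ |w.im| ∨ (R ≤ w.re ∧ 2 * M ≤ α * R)) :
    ∃ E : ℂ, ‖E‖ ≤ ((2 * M ^ 2 + M + 2) / α) / R ∧ Complex.Gamma (α * w + β) =
      Complex.exp ((Real.log (2 * Real.pi) : ℝ) / 2
        + (α * w + β - 1 / 2) * ((Real.log α : ℝ) + Complex.log w) - α * w + E) := by
  set γ : ℝ := β / α with hγ
  have hαγ : α * γ = β := by rw [hγ]; field_simp
  have hαc : (α : ℂ) ≠ 0 := by exact_mod_cast hα.ne'
  have hαγc : (α : ℂ) * γ = β := by exact_mod_cast hαγ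
  have hγM : |γ| ≤ M / α := by rw [hγ, abs_div, abs_of_pos hα]; gcongr
  have hM : 0 ≤ M := (abs_nonneg β).trans hβ
  -- The shift γ is real, so it leaves Im w unchanged; in the other case 2M ≤ αR makes it at most
  -- R/2. Half of the margin R survives either way.
  have hmem : ∀ v : ℝ, 0 ≤ v → v ≤ 1 → w + v * (γ : ℂ) ∈ farRegion (R / 2) := by
    intro v hv0 hv1
    rcases hw with h | ⟨h, h'⟩
    · right
      have : (w + v * (γ : ℂ)).im = w.im := by simp
      rw [this]; linarith
    · left
      have h1 : (w + v * (γ : ℂ)).re = w.re + v * γ := by simp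
      have h2 : M / α ≤ R / 2 := by rw [div_le_iff₀ hα]; linarith
      have h3 : |v * γ| ≤ |γ| := by
        rw [abs_mul, abs_of_nonneg hv0]; exact mul_le_of_le_one_left (abs_nonneg _) hv1
      have h4 := neg_abs_le (v * γ)
      rw [h1]; linarith
  have hs : ∀ v : ℝ, 0 ≤ v → v ≤ 1 → w + v * (γ : ℂ) ∈ Complex.slitPlane := fun v h0 h1 =>
    mem_slitPlane_of_mem_farRegion (by positivity) (hmem v h0 h1)
  have hn : ∀ v : ℝ, 0 ≤ v → v ≤ 1 → R / 2 ≤ ‖w + v * (γ : ℂ)‖ := fun v h0 h1 =>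
    le_norm_of_mem_farRegion (hmem v h0 h1)
  have hd := norm_log_add_sub_log_le (by positivity) hs hn (v := 1) (by simp)
  have hd2 := norm_add_mul_log_sub_sub_le (by positivity) hs hn
  simp only [Complex.ofReal_one, one_mul, Complex.norm_real, Real.norm_eq_abs] at hd hd2
  have hwγ : w + (γ : ℂ) ∈ farRegion (R / 2) := by simpa using hmem 1 (by norm_num) le_rfl
  have heq : (α : ℂ) * w + β = α * (w + γ) := by rw [mul_add, hαγc]
  have hfar : (α : ℂ) * w + β ∈ farRegion (α * R / 2) := by
    rw [heq, mul_div_assoc]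
    rcases hwγ with h | h
    · left
      rw [Complex.re_ofReal_mul]; gcongr
    · right
      rw [Complex.im_ofReal_mul, abs_mul, abs_of_pos hα]; gcongr
  obtain ⟨J, hJ, hΓ⟩ := exists_Gamma_eq_stirling (by positivity) hfar
  set d : ℂ := Complex.log (w + γ) - Complex.log w with hddef
  -- Three sources of error: replacing log (w+γ) by log w in the linear factor, the same replacement
  -- in the -1/2 term, and the Stirling error J.
  refine ⟨α * ((w + γ) * d - γ) - d / 2 + J, ?_, ?_⟩
  · have h1 : ‖(α : ℂ) * ((w + γ) * d - γ)‖ ≤ α * ((M / α) ^ 2 / (R / 2)) := by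
      rw [norm_mul, Complex.norm_real, Real.norm_of_nonneg hα.le]
      gcongr
      exact hd2.trans (by gcongr)
    have h2 : ‖d / 2‖ ≤ (M / α) / R := by
      rw [norm_div, Complex.norm_ofNat, div_le_iff₀ (by norm_num)]
      refine hd.trans ?_
      calc |γ| / (R / 2) ≤ (M / α) / (R / 2) := by gcongr
        _ = _ := by field_simp
    calc _ ≤ ‖(α : ℂ) * ((w + γ) * d - γ)‖ + ‖d / 2‖ + ‖J‖ :=
          (norm_add_le _ _).trans (by gcongr; exact norm_sub_le _ _)
      _ ≤ α * ((M / α) ^ 2 / (R / 2)) + (M / α) / R + 1 / (α * R / 2) := by gcongr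
      _ = _ := by field_simp
  · have hlog : Complex.log (α * w + β) = (Real.log α : ℝ) + Complex.log w + d := by
      rw [heq, Complex.log_ofReal_mul hα (Complex.slitPlane_ne_zero
        (mem_slitPlane_of_mem_farRegion (by positivity) hwγ)), hddef]
      ring
    have hsqrt : ((√(2 * Real.pi) : ℝ) : ℂ)
        = Complex.exp ((Real.log (2 * Real.pi) : ℝ) / 2) := by
      rw [Real.sqrt_eq_rpow, Real.rpow_def_of_pos (by positivity), Complex.ofReal_exp]
      congr 1
      push_cast
      ring
    rw [hΓ, hsqrt, ← Complex.exp_add, stirlingMain, hlog]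
    congr 1
    linear_combination (-(d : ℂ) + 1) * hαγc

/-- The constant in the asymptotic expansion of the gamma ratio. -/
noncomputable def errorConst (A : Fin p → ℝ) (B : Fin q → ℝ) (M : ℝ) : ℝ :=
  ∑ k, (2 * M ^ 2 + M + 2) / A k + ∑ j, (2 * M ^ 2 + M + 2) / B j

lemma errorConst_nonneg {A : Fin p → ℝ} {B : Fin q → ℝ} (hA : ∀ k, 0 < A k) (hB : ∀ j, 0 < B j)
    {M : ℝ} (hM : 0 ≤ M) : 0 ≤ errorConst A B M :=
  add_nonneg (Finset.sum_nonneg fun k _ => by have := hA k; positivity)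
    (Finset.sum_nonneg fun j _ => by have := hB j; positivity)

lemma rho_pos {A : Fin p → ℝ} {B : Fin q → ℝ} (hA : ∀ k, 0 < A k) (hB : ∀ j, 0 < B j) :
    0 < rho A B :=
  mul_pos (Finset.prod_pos fun k _ => Real.rpow_pos_of_pos (hA k) _)
    (Finset.prod_pos fun j _ => Real.rpow_pos_of_pos (hB j) _)

lemma rho_eq_exp {A : Fin p → ℝ} {B : Fin q → ℝ} (hA : ∀ k, 0 < A k) (hB : ∀ j, 0 < B j) :
    rho A B = Real.exp (∑ k, Real.log (A k) * A k - ∑ j, Real.log (B j) * B j) := by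
  unfold rho
  rw [sub_eq_add_neg, Real.exp_add, ← Finset.sum_neg_distrib, Real.exp_sum, Real.exp_sum]
  congr 1
  · exact Finset.prod_congr rfl fun k _ => Real.rpow_def_of_pos (hA k) _
  · refine Finset.prod_congr rfl fun j _ => ?_
    rw [Real.rpow_def_of_pos (hB j), mul_neg]

lemma nu_eq_exp {A : Fin p → ℝ} {B : Fin q → ℝ} (hA : ∀ k, 0 < A k) (hB : ∀ j, 0 < B j)
    (a : Fin p → ℝ) (b : Fin q → ℝ) :
    nu A a B b = Real.exp (Real.log (2 * Real.pi) * (((p : ℝ) - q) / 2)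
      + ∑ k, Real.log (A k) * (a k - 1 / 2) + ∑ j, Real.log (B j) * (1 / 2 - b j)) := by
  unfold nu
  rw [Real.exp_add, Real.exp_add, Real.exp_sum, Real.exp_sum]
  congr 1
  · congr 1
    · exact Real.rpow_def_of_pos (by positivity) _
    · exact Finset.prod_congr rfl fun k _ => Real.rpow_def_of_pos (hA k) _
  · exact Finset.prod_congr rfl fun k _ => Real.rpow_def_of_pos (hB k) _

/-- The gamma ratio divided by `ρ ^ s`. -/
noncomputable def normRatio (A a : Fin p → ℝ) (B b : Fin q → ℝ) (s : ℂ) : ℂ :=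
  gammaRatio A a B b s * Complex.exp (-(Real.log (rho A B) : ℝ) * s)

/-- Asymptotics of the normalised gamma ratio in the delta neutral case. -/
theorem exists_normRatio_eq {A : Fin p → ℝ} {B : Fin q → ℝ} (hA : ∀ k, 0 < A k)
    (hB : ∀ j, 0 < B j) (hΔ : Delta A B = 0) {a : Fin p → ℝ} {b : Fin q → ℝ} {M R : ℝ}
    (ha : ∀ k, |a k| ≤ M) (hb : ∀ j, |b j| ≤ M) (hR : 0 < R) {w : ℂ}
    (hw : R ≤ |w.im| ∨ (R ≤ w.re ∧ (∀ k, 2 * M ≤ A k * R) ∧ ∀ j, 2 * M ≤ B j * R)) :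
    ∃ E : ℂ, ‖E‖ ≤ errorConst A B M / R ∧
      normRatio A a B b w = nu A a B b * w ^ (-(mu a b : ℂ)) * Complex.exp E := by
  have hw0 : w ≠ 0 := by
    rintro rfl
    rcases hw with h | ⟨h, -⟩ <;> simp at h <;> linarith
  choose E hE hΓ using fun k => exists_Gamma_mul_add_eq_exp (w := w) (hA k) (ha k) hR
    (hw.imp_right fun h => ⟨h.1, h.2.1 k⟩)
  choose E' hE' hΓ' using fun j => exists_Gamma_mul_add_eq_exp (w := w) (hB j) (hb j) hR
    (hw.imp_right fun h => ⟨h.1, h.2.2 j⟩)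
  refine ⟨∑ k, E k - ∑ j, E' j, ?_, ?_⟩
  · unfold errorConst
    rw [add_div, Finset.sum_div, Finset.sum_div]
    exact (norm_sub_le _ _).trans (add_le_add ((norm_sum_le _ _).trans
      (Finset.sum_le_sum fun k _ => hE k)) ((norm_sum_le _ _).trans
      (Finset.sum_le_sum fun k _ => hE' k)))
  · unfold normRatio gammaRatio
    rw [Finset.prod_congr rfl fun k _ => hΓ k, Finset.prod_congr rfl fun k _ => hΓ' k,
      ← Complex.exp_sum, ← Complex.exp_sum, ← Complex.exp_sub, ← Complex.exp_add,
      nu_eq_exp hA hB, rho_eq_exp hA hB, Real.log_exp, Complex.cpow_def_of_ne_zero hw0,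
      Complex.ofReal_exp, ← Complex.exp_add, ← Complex.exp_add]
    congr 1
    have hsum : ∀ {n : ℕ} (α β : Fin n → ℝ) (e : Fin n → ℂ), ∑ k, (((Real.log (2 * Real.pi) : ℝ) : ℂ)
        / 2 + (α k * w + β k - 1 / 2) * ((Real.log (α k) : ℝ) + Complex.log w) - α k * w + e k)
        = n * (((Real.log (2 * Real.pi) : ℝ) : ℂ) / 2) + w * ((∑ k, Real.log (α k) * α k : ℝ) : ℂ)
          + ((∑ k, Real.log (α k) * (β k - 1 / 2) : ℝ) : ℂ)
          + (w * Complex.log w - w) * ((∑ k, α k : ℝ) : ℂ) + Complex.log w * ((∑ k, β k : ℝ) : ℂ)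
          - n * (Complex.log w / 2) + ∑ k, e k := by
      intro n α β e
      push_cast
      simp only [Finset.mul_sum]
      rw [show (n : ℂ) * ((Real.log (2 * Real.pi) : ℝ) / 2)
        = ∑ k : Fin n, ((Real.log (2 * Real.pi) : ℝ) : ℂ) / 2 by simp,
        show (n : ℂ) * (Complex.log w / 2) = ∑ k : Fin n, (Complex.log w / 2) by simp]
      simp only [← Finset.sum_add_distrib, ← Finset.sum_sub_distrib]
      refine Finset.sum_congr rfl fun k _ => ?_
      ring
    rw [hsum, hsum]
    have hneg : ∑ j, Real.log (B j) * (1 / 2 - b j) = -∑ j, Real.log (B j) * (b j - 1 / 2) := by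
      rw [← Finset.sum_neg_distrib]
      exact Finset.sum_congr rfl fun j _ => by ring
    -- Here Δ = 0 enters: the terms w log w - w from numerator and denominator cancel, leaving only
    -- ρ^w and a power of w.
    have hAB : ∑ j, B j = ∑ k, A k := by
      unfold Delta at hΔ; linarith
    rw [hneg, hAB]
    unfold mu
    simp only [Complex.ofReal_add, Complex.ofReal_sub, Complex.ofReal_neg, Complex.ofReal_mul,
      Complex.ofReal_div, Complex.ofReal_natCast, Complex.ofReal_ofNat]
    ring

/-! ### Left loop integrals -/

/-- Cauchy's theorem for a half-infinite horizontal strip. -/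
lemma integral_strip_eq_zero {F : ℂ → ℂ} {t C c φ φ' : ℝ} (ht : 0 < t)
    (hF : DifferentiableOn ℂ F (Set.Iic c ×ℂ Set.uIcc φ φ'))
    (hC : ∀ w ∈ Set.Iic c ×ℂ Set.uIcc φ φ', ‖F w‖ ≤ C * Real.exp (t * w.re)) :
    (∫ u in Set.Iic c, F (u + φ * I)) - (∫ u in Set.Iic c, F (u + φ' * I))
      + I * ∫ y in φ..φ', F (c + y * I) = 0 := by
  have hint : ∀ y ∈ Set.uIcc φ φ', IntegrableOn (fun u : ℝ => F (u + y * I)) (Set.Iic c) := by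
    intro y hy
    have hmaps : Set.MapsTo (fun u : ℝ => (u : ℂ) + y * I) (Set.Iic c)
        (Set.Iic c ×ℂ Set.uIcc φ φ') := by
      intro u hu
      rw [mem_reProdIm]
      simpa using ⟨hu, hy⟩
    refine Integrable.mono' ((integrableOn_exp_mul_Iic ht c).const_mul C)
      ((hF.continuousOn.comp (by fun_prop) hmaps).aestronglyMeasurable measurableSet_Iic) ?_
    filter_upwards [ae_restrict_mem measurableSet_Iic] with u hu
    simpa using hC _ (hmaps hu)
  have h1 := intervalIntegral_tendsto_integral_Iic c (hint φ Set.left_mem_uIcc) tendsto_id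
  have h2 := intervalIntegral_tendsto_integral_Iic c (hint φ' Set.right_mem_uIcc) tendsto_id
  have h3 : Tendsto (fun N : ℝ => I * ∫ y in φ..φ', F (N + y * I)) atBot (𝓝 0) := by
    have h4 : Tendsto (fun N : ℝ => C * Real.exp (t * N) * |φ' - φ|) atBot
        (𝓝 (C * 0 * |φ' - φ|)) :=
      ((Real.tendsto_exp_atBot.comp (tendsto_id.const_mul_atBot ht)).const_mul C).mul_const _
    rw [mul_zero, zero_mul] at h4
    refine squeeze_zero_norm' ?_ h4
    filter_upwards [eventually_le_atBot c] with N hN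
    rw [norm_mul, norm_I, one_mul]
    refine intervalIntegral.norm_integral_le_of_norm_le_const fun y hy => ?_
    have := hC (N + y * I) (by
      rw [mem_reProdIm]
      simpa using ⟨hN, Set.uIoc_subset_uIcc hy⟩)
    simpa using this
  have h5 := ((h1.sub h2).add_const (I * ∫ y in φ..φ', F (c + y * I))).sub h3
  rw [sub_zero] at h5
  refine tendsto_nhds_unique h5 (tendsto_const_nhds.congr' ?_)
  filter_upwards [eventually_le_atBot c] with N hN
  have := integral_boundary_rect_eq_zero_of_differentiableOn F (N + φ * I) (c + φ' * I)
    (hF.mono (by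
      simp only [add_re, ofReal_re, mul_re, I_re, mul_zero, ofReal_im, I_im, mul_one, sub_self,
        add_zero, add_im, mul_im, zero_add]
      rw [Set.uIcc_of_le hN]
      exact Set.inter_subset_inter (Set.preimage_mono Set.Icc_subset_Iic_self) le_rfl))
  simp only [add_re, ofReal_re, mul_re, I_re, mul_zero, ofReal_im, I_im, mul_one, sub_self,
        add_zero, add_im, mul_im, zero_add, smul_eq_mul] at this
  simpa using this.symm

/-- Functions on the slit plane that decay exponentially to the left, away from the real axis. -/
structure LoopAdmissible (F : ℂ → ℂ) (t : ℝ) : Prop where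
  diff : DifferentiableOn ℂ F slitPlane
  bound : ∀ δ : ℝ, 0 < δ → ∃ C : ℝ, ∀ w : ℂ, δ ≤ |w.im| → ‖F w‖ ≤ C * Real.exp (t * w.re)

namespace LoopAdmissible

variable {F G : ℂ → ℂ} {t : ℝ}

lemma integrableOn (hF : LoopAdmissible F t) (ht : 0 < t) {y : ℝ} (hy : y ≠ 0) (c : ℝ) :
    IntegrableOn (fun u : ℝ => F (u + y * I)) (Set.Iic c) := by
  obtain ⟨C, hC⟩ := hF.bound |y| (abs_pos.mpr hy)
  refine Integrable.mono' ((integrableOn_exp_mul_Iic ht c).const_mul C)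
    ((hF.diff.continuousOn.comp (by fun_prop) ?_).aestronglyMeasurable measurableSet_Iic) ?_
  · intro u _
    right
    simpa using hy
  · refine Eventually.of_forall fun u => ?_
    simpa using hC (u + y * I) (by simp)

lemma continuous_vertical (hF : LoopAdmissible F t) {c : ℝ} (hc : 0 < c) :
    Continuous fun y : ℝ => F (c + y * I) := by
  refine hF.diff.continuousOn.comp_continuous (by fun_prop) fun y => ?_
  left
  simpa using hc

lemma sub (hF : LoopAdmissible F t) (hG : LoopAdmissible G t) :
    LoopAdmissible (fun w => F w - G w) t where
  diff := hF.diff.sub hG.diff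
  bound δ hδ := by
    obtain ⟨C, hC⟩ := hF.bound δ hδ
    obtain ⟨C', hC'⟩ := hG.bound δ hδ
    refine ⟨C + C', fun w hw => (norm_sub_le _ _).trans ?_⟩
    rw [add_mul]
    exact add_le_add (hC w hw) (hC' w hw)

lemma const_mul (hF : LoopAdmissible F t) (a : ℂ) : LoopAdmissible (fun w => a * F w) t where
  diff := hF.diff.const_mul a
  bound δ hδ := by
    obtain ⟨C, hC⟩ := hF.bound δ hδ
    refine ⟨‖a‖ * C, fun w hw => ?_⟩
    rw [norm_mul, mul_assoc]
    exact mul_le_mul_of_nonneg_left (hC w hw) (norm_nonneg a)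

lemma leftLoopIntegral_sub (hF : LoopAdmissible F t) (hG : LoopAdmissible G t) (ht : 0 < t)
    {φ c : ℝ} (hφ : 0 < φ) (hc : 0 < c) :
    leftLoopIntegral (fun w => F w - G w) (-φ) φ c
      = leftLoopIntegral F (-φ) φ c - leftLoopIntegral G (-φ) φ c := by
  unfold leftLoopIntegral
  rw [integral_sub (hF.integrableOn ht (neg_ne_zero.mpr hφ.ne') c)
      (hG.integrableOn ht (neg_ne_zero.mpr hφ.ne') c),
    integral_sub (hF.integrableOn ht hφ.ne' c) (hG.integrableOn ht hφ.ne' c),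
    intervalIntegral.integral_sub ((hF.continuous_vertical hc).intervalIntegrable _ _)
      ((hG.continuous_vertical hc).intervalIntegrable _ _)]
  ring

/-- The two loops differ by a rectangle in the right half-plane, where F is holomorphic. -/
lemma leftLoopIntegral_eq_of_abscissa (hF : LoopAdmissible F t) (ht : 0 < t)
    {φ c c' : ℝ} (hφ : 0 < φ) (hc : 0 < c) (hc' : 0 < c') :
    leftLoopIntegral F (-φ) φ c = leftLoopIntegral F (-φ) φ c' := by
  have h := integral_boundary_rect_eq_zero_of_differentiableOn F (c + (-φ : ℝ) * I) (c' + φ * I)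
    (hF.diff.mono (by
      intro w hw
      rw [mem_reProdIm] at hw
      left
      have := hw.1
      simp only [add_re, ofReal_re, mul_re, I_re, mul_zero, ofReal_im, I_im, mul_one, sub_self,
        add_zero] at this
      exact (lt_min hc hc').trans_le this.1))
  simp only [add_re, ofReal_re, mul_re, I_re, mul_zero, ofReal_im, I_im, mul_one, sub_self,
        add_zero, add_im, mul_im, zero_add, smul_eq_mul] at h
  have h1 := intervalIntegral.integral_Iic_sub_Iic
    (hF.integrableOn ht (neg_ne_zero.mpr hφ.ne') c) (hF.integrableOn ht (neg_ne_zero.mpr hφ.ne') c')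
  have h2 := intervalIntegral.integral_Iic_sub_Iic
    (hF.integrableOn ht hφ.ne' c) (hF.integrableOn ht hφ.ne' c')
  unfold leftLoopIntegral
  linear_combination h2 - h1 - h

/-- The two loops differ by one half-infinite strip above the real axis and one below; each stays at
distance at least min φ φ' from the axis, so the exponential bound holds on it. -/
lemma leftLoopIntegral_eq_of_height (hF : LoopAdmissible F t) (ht : 0 < t)
    {φ φ' c : ℝ} (hφ : 0 < φ) (hφ' : 0 < φ') (hc : 0 < c) :
    leftLoopIntegral F (-φ) φ c = leftLoopIntegral F (-φ') φ' c := by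
  have hδ : 0 < min φ φ' := lt_min hφ hφ'
  obtain ⟨C, hC⟩ := hF.bound (min φ φ') hδ
  have hup : ∀ y ∈ Set.uIcc φ φ', min φ φ' ≤ |y| := fun y hy => hy.1.trans (le_abs_self y)
  have hlow : ∀ y ∈ Set.uIcc (-φ) (-φ'), min φ φ' ≤ |y| := by
    intro y hy
    have h2 := hy.2
    rw [max_neg_neg] at h2
    exact le_abs.mpr (Or.inr (by linarith))
  have hstrip : ∀ ψ ψ' : ℝ, (∀ y ∈ Set.uIcc ψ ψ', min φ φ' ≤ |y|) →
      (∫ u in Set.Iic c, F (u + ψ * I)) - (∫ u in Set.Iic c, F (u + ψ' * I))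
      + I * ∫ y in ψ..ψ', F (c + y * I) = 0 := by
    intro ψ ψ' h
    refine integral_strip_eq_zero (C := C) ht (hF.diff.mono fun w hw => ?_) fun w hw => ?_
    · rw [mem_reProdIm] at hw
      exact Or.inr (abs_pos.mp (hδ.trans_le (h _ hw.2)))
    · rw [mem_reProdIm] at hw
      exact hC w (h _ hw.2)
  have h1 := hstrip φ φ' hup
  have h2 := hstrip (-φ) (-φ') hlow
  have hii : ∀ x y : ℝ, IntervalIntegrable (fun y : ℝ => F (c + y * I)) volume x y :=
    fun x y => (hF.continuous_vertical hc).intervalIntegrable _ _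
  have h3 := intervalIntegral.integral_add_adjacent_intervals (hii (-φ) (-φ')) (hii (-φ') φ')
  have h4 := intervalIntegral.integral_add_adjacent_intervals (hii (-φ) φ) (hii φ φ')
  unfold leftLoopIntegral
  linear_combination h2 - h1 + I * (h4 - h3)

lemma leftLoopIntegral_eq (hF : LoopAdmissible F t) (ht : 0 < t)
    {φ φ' c c' : ℝ} (hφ : 0 < φ) (hφ' : 0 < φ') (hc : 0 < c) (hc' : 0 < c') :
    leftLoopIntegral F (-φ) φ c = leftLoopIntegral F (-φ') φ' c' :=
  (hF.leftLoopIntegral_eq_of_height ht hφ hφ' hc).trans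
    (hF.leftLoopIntegral_eq_of_abscissa ht hφ' hc hc')

end LoopAdmissible

lemma norm_leftLoopIntegral_le {F : ℂ → ℂ} {t C C' φ c : ℝ} (ht : 0 < t) (hφ : 0 < φ)
    (h₁ : ∀ u ≤ c, ‖F (u + (-φ : ℝ) * I)‖ ≤ C * Real.exp (t * u))
    (h₂ : ∀ u ≤ c, ‖F (u + φ * I)‖ ≤ C * Real.exp (t * u))
    (h₃ : ∀ y : ℝ, |y| ≤ φ → ‖F (c + y * I)‖ ≤ C') :
    ‖leftLoopIntegral F (-φ) φ c‖ ≤ 2 * C * (Real.exp (t * c) / t) + 2 * φ * C' := by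
  have hbound : ∀ ψ : ℝ, (∀ u ≤ c, ‖F (u + ψ * I)‖ ≤ C * Real.exp (t * u)) →
      ‖∫ u in Set.Iic c, F (u + ψ * I)‖ ≤ C * (Real.exp (t * c) / t) := by
    intro ψ h
    rw [← integral_exp_mul_Iic ht, ← integral_const_mul]
    refine norm_integral_le_of_norm_le ((integrableOn_exp_mul_Iic ht c).const_mul C) ?_
    filter_upwards [ae_restrict_mem measurableSet_Iic] with u hu using h u hu
  have h4 : ‖∫ y in (-φ)..φ, F (c + y * I)‖ ≤ C' * |φ - -φ| := by
    refine intervalIntegral.norm_integral_le_of_norm_le_const fun y hy => h₃ y ?_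
    rw [Set.uIoc_of_le (by linarith)] at hy
    exact abs_le.mpr ⟨hy.1.le, hy.2⟩
  rw [show φ - -φ = 2 * φ by ring, abs_of_pos (by positivity)] at h4
  unfold leftLoopIntegral
  calc _ ≤ ‖∫ u in Set.Iic c, F (u + (-φ : ℝ) * I)‖ + ‖I * ∫ y in (-φ)..φ, F (c + y * I)‖
        + ‖∫ u in Set.Iic c, F (u + φ * I)‖ :=
        (norm_sub_le _ _).trans (by gcongr; exact norm_add_le _ _)
    _ ≤ C * (Real.exp (t * c) / t) + C' * (2 * φ) + C * (Real.exp (t * c) / t) := by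
        rw [norm_mul, norm_I, one_mul]
        gcongr
        · exact hbound _ h₁
        · exact hbound _ h₂
    _ = _ := by ring

/-- Dominated convergence for loop integrals. -/
lemma tendsto_leftLoopIntegral {ι : Type*} {l : Filter ι} [l.IsCountablyGenerated]
    {F : ι → ℂ → ℂ} {G : ℂ → ℂ} {t C φ c : ℝ} (ht : 0 < t) (hφ : 0 < φ)
    (hmeas : ∀ᶠ i in l, (∀ y : ℝ, y ≠ 0 → Continuous fun u : ℝ => F i (u + y * I)) ∧
      Continuous fun y : ℝ => F i (c + y * I))
    (h₁ : ∀ᶠ i in l, ∀ u ≤ c, ‖F i (u + (-φ : ℝ) * I)‖ ≤ C * Real.exp (t * u))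
    (h₂ : ∀ᶠ i in l, ∀ u ≤ c, ‖F i (u + φ * I)‖ ≤ C * Real.exp (t * u))
    (h₃ : ∀ᶠ i in l, ∀ y : ℝ, |y| ≤ φ → ‖F i (c + y * I)‖ ≤ C)
    (hlim : ∀ w ∈ slitPlane, Tendsto (fun i => F i w) l (𝓝 (G w))) (hc : 0 < c) :
    Tendsto (fun i => leftLoopIntegral (F i) (-φ) φ c) l (𝓝 (leftLoopIntegral G (-φ) φ c)) := by
  have hhor : ∀ ψ : ℝ, ψ ≠ 0 →
      (∀ᶠ i in l, ∀ u ≤ c, ‖F i (u + ψ * I)‖ ≤ C * Real.exp (t * u)) →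
      Tendsto (fun i => ∫ u in Set.Iic c, F i (u + ψ * I)) l
        (𝓝 (∫ u in Set.Iic c, G (u + ψ * I))) := by
    intro ψ hψ h
    refine tendsto_integral_filter_of_dominated_convergence (fun u => C * Real.exp (t * u)) ?_ ?_
      ((integrableOn_exp_mul_Iic ht c).const_mul C) ?_
    · filter_upwards [hmeas] with i hi using (hi.1 ψ hψ).aestronglyMeasurable
    · filter_upwards [h] with i hi
      filter_upwards [ae_restrict_mem measurableSet_Iic] with u hu using hi u hu
    · refine Eventually.of_forall fun u => hlim _ (Or.inr ?_)
      simpa using hψ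
  have hver : Tendsto (fun i => ∫ y in (-φ)..φ, F i (c + y * I)) l
      (𝓝 (∫ y in (-φ)..φ, G (c + y * I))) := by
    refine intervalIntegral.tendsto_integral_filter_of_dominated_convergence (fun _ => C) ?_ ?_
      (by simp) ?_
    · filter_upwards [hmeas] with i hi using hi.2.aestronglyMeasurable
    · filter_upwards [h₃] with i hi
      refine Eventually.of_forall fun y hy => hi y ?_
      rw [Set.uIoc_of_le (by linarith)] at hy
      exact abs_le.mpr ⟨hy.1.le, hy.2⟩
    · refine Eventually.of_forall fun y _ => hlim _ (Or.inl ?_)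
      simpa using hc
  exact ((hhor (-φ) (neg_ne_zero.mpr hφ.ne') h₁).add (hver.const_mul I)).sub (hhor φ hφ.ne' h₂)

lemma leftLoopIntegral_const_mul (a : ℂ) (F : ℂ → ℂ) (φ₁ φ₂ c : ℝ) :
    leftLoopIntegral (fun w => a * F w) φ₁ φ₂ c = a * leftLoopIntegral F φ₁ φ₂ c := by
  unfold leftLoopIntegral
  rw [integral_const_mul, integral_const_mul, intervalIntegral.integral_const_mul]
  ring

lemma leftLoopIntegral_comp_mul (F : ℂ → ℂ) {r : ℝ} (hr : 0 < r) (φ₁ φ₂ c : ℝ) :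
    leftLoopIntegral (fun w => F (r * w)) φ₁ φ₂ c
      = (r : ℂ)⁻¹ * leftLoopIntegral F (r * φ₁) (r * φ₂) (r * c) := by
  have hhor : ∀ ψ : ℝ, ∫ u in Set.Iic c, F (r * (u + ψ * I))
      = (r : ℂ)⁻¹ * ∫ u in Set.Iic (r * c), F (u + (r * ψ : ℝ) * I) := by
    intro ψ
    have h := Measure.setIntegral_comp_smul_of_pos volume
      (fun u : ℝ => F (u + (r * ψ : ℝ) * I)) (Set.Iic c) hr
    rw [LinearOrderedField.smul_Iic hr] at h
    simp only [Module.finrank_self, pow_one] at h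
    rw [real_smul, ofReal_inv] at h
    rw [← h]
    refine integral_congr_ae (Eventually.of_forall fun u => ?_)
    simp only [smul_eq_mul]
    congr 1
    push_cast
    ring
  have hver : ∫ y in φ₁..φ₂, F (r * (c + y * I))
      = (r : ℂ)⁻¹ * ∫ y in (r * φ₁)..(r * φ₂), F ((r * c : ℝ) + y * I) := by
    have h := intervalIntegral.integral_comp_mul_left (a := φ₁) (b := φ₂)
      (fun y : ℝ => F ((r * c : ℝ) + y * I)) hr.ne'
    rw [real_smul, ofReal_inv] at h
    rw [← h]
    refine intervalIntegral.integral_congr fun y _ => ?_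
    congr 1
    push_cast
    ring
  unfold leftLoopIntegral
  rw [hhor, hhor, hver]
  ring

/-- The loop integral of a derivative vanishes. -/
lemma leftLoopIntegral_deriv_eq_zero {F F' : ℂ → ℂ} {t : ℝ} (ht : 0 < t)
    (hF : LoopAdmissible F t) (hF' : LoopAdmissible F' t)
    (hd : ∀ w ∈ slitPlane, HasDerivAt F (F' w) w) {φ c : ℝ} (hφ : 0 < φ) (hc : 0 < c) :
    leftLoopIntegral F' (-φ) φ c = 0 := by
  have hhor : ∀ ψ : ℝ, ψ ≠ 0 → ∫ u in Set.Iic c, F' (u + ψ * I) = F (c + ψ * I) := by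
    intro ψ hψ
    have hder : ∀ u : ℝ, HasDerivAt (fun u : ℝ => F (u + ψ * I)) (F' (u + ψ * I)) u := by
      intro u
      have h0 : HasDerivAt (fun u : ℝ => (u : ℂ) + ψ * I) 1 u :=
        Complex.ofRealCLM.hasDerivAt.add_const _
      simpa [Function.comp_def] using (hd (u + ψ * I) (Or.inr (by simpa using hψ))).comp u h0
    have hlim : Tendsto (fun u : ℝ => F (u + ψ * I)) atBot (𝓝 0) := by
      obtain ⟨C, hC⟩ := hF.bound |ψ| (abs_pos.mpr hψ)
      have h4 : Tendsto (fun u : ℝ => C * Real.exp (t * u)) atBot (𝓝 (C * 0)) :=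
        (Real.tendsto_exp_atBot.comp (tendsto_id.const_mul_atBot ht)).const_mul C
      rw [mul_zero] at h4
      exact squeeze_zero_norm (fun u => by simpa using hC (u + ψ * I) (by simp)) h4
    have := integral_Iic_of_hasDerivAt_of_tendsto' (a := c) (fun u _ => hder u)
      (hF'.integrableOn ht hψ c) hlim
    simpa using this
  have hver : I * ∫ y in (-φ)..φ, F' (c + y * I) = F (c + φ * I) - F (c + (-φ : ℝ) * I) := by
    rw [← intervalIntegral.integral_const_mul]
    refine intervalIntegral.integral_eq_sub_of_hasDerivAt (f := fun y : ℝ => F (c + y * I))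
      (fun y _ => ?_) (((hF'.continuous_vertical hc).const_mul I).intervalIntegrable _ _)
    have h0 : HasDerivAt (fun y : ℝ => (c : ℂ) + y * I) (1 * I) y :=
      (Complex.ofRealCLM.hasDerivAt.mul_const I).const_add _
    have := (hd (c + y * I) (Or.inl (by simpa using hc))).comp y h0
    simpa [mul_comm, Function.comp_def] using this
  unfold leftLoopIntegral
  rw [hhor _ (neg_ne_zero.mpr hφ.ne'), hhor _ hφ.ne', hver]
  ring

/-! ### Hankel's integral -/

/-- The function `w ^ (-μ) * exp (t w)`. -/
noncomputable def powExp (μ t : ℝ) (w : ℂ) : ℂ := w ^ (-(μ : ℂ)) * exp (t * w)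

lemma norm_cpow_neg_ofReal (μ : ℝ) {w : ℂ} (hw : w ≠ 0) : ‖w ^ (-(μ : ℂ))‖ = ‖w‖ ^ (-μ) := by
  rw [norm_cpow_of_ne_zero hw]
  simp

lemma norm_cpow_neg_ofReal_le {μ δ : ℝ} (hμ : 0 ≤ μ) (hδ : 0 < δ) {w : ℂ} (hw : δ ≤ ‖w‖) :
    ‖w ^ (-(μ : ℂ))‖ ≤ δ ^ (-μ) := by
  rw [norm_cpow_neg_ofReal μ (norm_pos_iff.mp (hδ.trans_le hw))]
  exact Real.rpow_le_rpow_of_nonpos hδ hw (by linarith)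

lemma norm_exp_ofReal_mul (t : ℝ) (w : ℂ) : ‖exp (t * w)‖ = Real.exp (t * w.re) := by
  rw [norm_exp, re_ofReal_mul]

lemma hasDerivAt_powExp (μ t : ℝ) {w : ℂ} (hw : w ∈ slitPlane) :
    HasDerivAt (powExp μ t) (t * powExp μ t w - μ * powExp (μ + 1) t w) w := by
  have h1 : HasDerivAt (fun w : ℂ => w ^ (-(μ : ℂ))) (-(μ : ℂ) * w ^ (-(μ : ℂ) - 1) * 1) w :=
    (hasDerivAt_id w).cpow_const hw
  have h2 : HasDerivAt (fun w : ℂ => exp (t * w)) (exp (t * w) * (t * 1)) w :=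
    ((hasDerivAt_id w).const_mul (t : ℂ)).cexp
  refine (h1.mul h2).congr_deriv ?_
  unfold powExp
  rw [show -(((μ + 1 : ℝ)) : ℂ) = -(μ : ℂ) - 1 by push_cast; ring]
  ring

lemma loopAdmissible_powExp {μ : ℝ} (hμ : 0 ≤ μ) (t : ℝ) : LoopAdmissible (powExp μ t) t where
  diff w hw := (hasDerivAt_powExp μ t hw).differentiableAt.differentiableWithinAt
  bound δ hδ := by
    refine ⟨δ ^ (-μ), fun w hw => ?_⟩
    rw [powExp, norm_mul, norm_exp_ofReal_mul]
    gcongr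
    exact norm_cpow_neg_ofReal_le hμ hδ (hw.trans (abs_im_le_norm w))

/-- Hankel's loop integral `(2πi)⁻¹ ∫ w ^ (-μ) e ^ w dw`. -/
noncomputable def hankel (μ : ℝ) : ℂ :=
  (2 * Real.pi * I)⁻¹ * leftLoopIntegral (powExp μ 1) (-1) 1 1

/-- The derivative of w^{-μ} e^w is w^{-μ} e^w - μ w^{-μ-1} e^w, and its loop integral vanishes.
This is the functional equation of 1/Γ, and the source of the factor μ in the approximate identity.
-/
lemma hankel_eq_mul {μ : ℝ} (hμ : 0 ≤ μ) : hankel μ = μ * hankel (μ + 1) := by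
  have h1 := loopAdmissible_powExp hμ 1
  have h2 := (loopAdmissible_powExp (add_nonneg hμ zero_le_one) 1).const_mul μ
  have h3 := leftLoopIntegral_deriv_eq_zero one_pos h1 (h1.sub h2)
    (fun w hw => by simpa using hasDerivAt_powExp μ 1 hw) one_pos one_pos
  rw [h1.leftLoopIntegral_sub h2 one_pos one_pos one_pos, leftLoopIntegral_const_mul] at h3
  unfold hankel
  rw [sub_eq_zero.mp h3]
  ring

lemma hankel_zero : hankel 0 = 0 := by simpa using hankel_eq_mul le_rfl

lemma integral_inv_one_add_mul_I : ∫ y in (-1 : ℝ)..1, (1 + y * I)⁻¹ = Real.pi / 2 := by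
  have hd : ∀ y : ℝ, HasDerivAt (fun y : ℝ => -I * log (1 + y * I)) ((1 + y * I)⁻¹) y := by
    intro y
    have h0 : HasDerivAt (fun y : ℝ => (1 : ℂ) + y * I) (1 * I) y :=
      (Complex.ofRealCLM.hasDerivAt.mul_const I).const_add _
    have h1 := (h0.clog_real (Or.inl (by simp))).const_mul (-I)
    refine h1.congr_deriv ?_
    rw [one_mul, div_eq_mul_inv, ← mul_assoc, neg_mul, I_mul_I, neg_neg, one_mul]
  have hne : ∀ y : ℝ, (1 : ℂ) + y * I ≠ 0 := fun y h => by
    have := congrArg re h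
    simp at this
  rw [intervalIntegral.integral_eq_sub_of_hasDerivAt (fun y _ => hd y)
    ((Continuous.inv₀ (by fun_prop) hne).intervalIntegrable _ _)]
  have h1 : log (1 + (1 : ℝ) * I) - log (1 + (-1 : ℝ) * I) = Real.pi / 2 * I := by
    have hconj : (1 : ℂ) + (-1 : ℝ) * I = (starRingEnd ℂ) (1 + (1 : ℝ) * I) := by simp
    have harg : arg (1 + (1 : ℝ) * I) = Real.pi / 4 := by
      have := arg_mul_cos_add_sin_mul_I (r := √2) (θ := Real.pi / 4) (by positivity)
        ⟨by linarith [Real.pi_pos], by linarith [Real.pi_pos]⟩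
      rw [← this]
      congr 1
      rw [← ofReal_cos, ← ofReal_sin, Real.cos_pi_div_four,
        Real.sin_pi_div_four, mul_add, ← mul_assoc, ← ofReal_mul]
      have : √2 * (√2 / 2) = 1 := by
        rw [← mul_div_assoc, Real.mul_self_sqrt (by norm_num)]; norm_num
      rw [this]; simp
    rw [hconj, log_conj _ (by rw [harg]; linarith [Real.pi_pos])]
    rw [sub_conj, log_im, harg]
    push_cast
    ring
  rw [← mul_sub, h1]
  linear_combination (-(Real.pi : ℂ) / 2) * I_mul_I

/-- The residue of 1/w, found by turning each side of the square onto its right side with a power of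
I; each side then contributes π/2 · I. -/
lemma boundary_integral_inv :
    (∫ x in (-1 : ℝ)..1, ((x : ℂ) + (-1 : ℝ) * I)⁻¹) - (∫ x in (-1 : ℝ)..1, ((x : ℂ) + (1 : ℝ) * I)⁻¹)
      + I * (∫ y in (-1 : ℝ)..1, (((1 : ℝ) : ℂ) + y * I)⁻¹)
      - I * (∫ y in (-1 : ℝ)..1, (((-1 : ℝ) : ℂ) + y * I)⁻¹) = 2 * Real.pi * I := by
  have hneg : ∫ y in (-1 : ℝ)..1, (1 - y * I)⁻¹ = Real.pi / 2 := by
    rw [← integral_inv_one_add_mul_I]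
    have := intervalIntegral.integral_comp_neg (a := -1) (b := 1) (fun y : ℝ => (1 + y * I)⁻¹)
    rw [neg_neg] at this
    rw [← this]
    refine intervalIntegral.integral_congr fun y _ => ?_
    simp [sub_eq_add_neg]
  have h1 : ∫ x in (-1 : ℝ)..1, ((x : ℂ) + (-1 : ℝ) * I)⁻¹ = I * (Real.pi / 2) := by
    rw [← integral_inv_one_add_mul_I, ← intervalIntegral.integral_const_mul]
    refine intervalIntegral.integral_congr fun x _ => ?_
    have : (x : ℂ) + (-1 : ℝ) * I = (1 + x * I) * I⁻¹ := by
      rw [inv_I]; push_cast; linear_combination (x : ℂ) * I_mul_I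
    rw [this, mul_inv, inv_inv, mul_comm]
  have h2 : ∫ x in (-1 : ℝ)..1, ((x : ℂ) + (1 : ℝ) * I)⁻¹ = -I * (Real.pi / 2) := by
    rw [← hneg, ← intervalIntegral.integral_const_mul]
    refine intervalIntegral.integral_congr fun x _ => ?_
    have : (x : ℂ) + (1 : ℝ) * I = (1 - x * I) * (-I)⁻¹ := by
      rw [inv_neg, inv_I]; push_cast; linear_combination (x : ℂ) * I_mul_I
    rw [this, mul_inv, inv_inv, mul_comm]
  have h3 : ∫ y in (-1 : ℝ)..1, (((1 : ℝ) : ℂ) + y * I)⁻¹ = Real.pi / 2 := by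
    simpa using integral_inv_one_add_mul_I
  have h4 : ∫ y in (-1 : ℝ)..1, (((-1 : ℝ) : ℂ) + y * I)⁻¹ = -(Real.pi / 2) := by
    rw [← hneg, ← intervalIntegral.integral_neg]
    refine intervalIntegral.integral_congr fun y _ => ?_
    have : ((-1 : ℝ) : ℂ) + y * I = -(1 - y * I) := by push_cast; ring
    rw [this, inv_neg]
  rw [h1, h2, h3, h4]
  ring

/-- The residue of e^w/w at 0. The part of the loop left of Re w = -1 is closed off by Cauchy's
theorem in a strip that avoids 0, which leaves the square with corners ±1 ± i. -/
lemma hankel_one : hankel 1 = 1 := by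
  set F : ℂ → ℂ := powExp 1 1 with hF
  have hFeq : ∀ w, F w = w⁻¹ * exp w := fun w => by
    simp [hF, powExp, cpow_neg_one]
  have hadm := loopAdmissible_powExp zero_le_one 1
  rw [← hF] at hadm
  have hdiff : ∀ w, w ≠ 0 → DifferentiableAt ℂ F w := by
    intro w hw
    rw [show F = fun w => w⁻¹ * exp w from funext hFeq]
    exact (differentiableAt_inv hw).mul differentiable_exp.differentiableAt
  have hstrip := integral_strip_eq_zero (F := F) (t := 1) (C := 1) (c := -1) (φ := -1) (φ' := 1)
    one_pos
    (fun w hw => (hdiff w (by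
      rintro rfl
      rw [mem_reProdIm] at hw
      have := hw.1
      simp at this
      linarith)).differentiableWithinAt)
    (fun w hw => by
      rw [mem_reProdIm] at hw
      have h1 : 1 ≤ ‖w‖ := by
        have := abs_re_le_norm w
        have h2 : w.re ≤ -1 := hw.1
        rw [abs_of_neg (by linarith)] at this
        linarith
      rw [hFeq, norm_mul, norm_inv, norm_exp, one_mul, one_mul]
      exact mul_le_of_le_one_left (Real.exp_nonneg _) (inv_le_one_of_one_le₀ h1))
  -- The entire function (e^w - 1)/w: on the square it integrates to zero, so only 1/w contributes.
  let G : ℂ → ℂ := dslope exp 0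
  have hG : ∀ w, w ≠ 0 → F w = G w + w⁻¹ := by
    intro w hw
    rw [hFeq]
    simp only [G, dslope_of_ne _ hw, slope, vsub_eq_sub, sub_zero, exp_zero, smul_eq_mul]
    ring
  have hGd : Differentiable ℂ G := by
    rw [← differentiableOn_univ]
    exact (differentiableOn_dslope univ_mem).mpr differentiable_exp.differentiableOn
  have hrect := integral_boundary_rect_eq_zero_of_differentiableOn G
    ((-1 : ℝ) + (-1 : ℝ) * I) ((1 : ℝ) + (1 : ℝ) * I) hGd.differentiableOn
  simp only [add_re, ofReal_re, mul_re, I_re, mul_zero, ofReal_im, I_im, mul_one, sub_self,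
        add_zero, add_im, mul_im, zero_add, smul_eq_mul] at hrect
  have hinv := boundary_integral_inv
  have hedge : ∀ g : ℝ → ℂ, Continuous g → (∀ x, g x ≠ 0) →
      ∫ x in (-1 : ℝ)..1, F (g x)
        = (∫ x in (-1 : ℝ)..1, G (g x)) + ∫ x in (-1 : ℝ)..1, (g x)⁻¹ := by
    intro g hg hg0
    rw [← intervalIntegral.integral_add (f := fun x => G (g x)) (g := fun x => (g x)⁻¹)
      ((hGd.continuous.comp hg).intervalIntegrable _ _) ((hg.inv₀ hg0).intervalIntegrable _ _)]
    exact intervalIntegral.integral_congr fun x _ => hG _ (hg0 x)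
  have e1 := hedge (fun x => (x : ℂ) + (-1 : ℝ) * I) (by fun_prop) (fun x h => by
    simpa using congrArg im h)
  have e2 := hedge (fun x => (x : ℂ) + (1 : ℝ) * I) (by fun_prop) (fun x h => by
    simpa using congrArg im h)
  have e3 := hedge (fun y => ((1 : ℝ) : ℂ) + y * I) (by fun_prop) (fun x h => by
    simpa using congrArg re h)
  have e4 := hedge (fun y => ((-1 : ℝ) : ℂ) + y * I) (by fun_prop) (fun x h => by
    simpa using congrArg re h)
  have i1 := intervalIntegral.integral_Iic_sub_Iic
    (hadm.integrableOn one_pos (y := -1) (by norm_num) (-1))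
    (hadm.integrableOn one_pos (y := -1) (by norm_num) 1)
  have i2 := intervalIntegral.integral_Iic_sub_Iic
    (hadm.integrableOn one_pos (y := 1) (by norm_num) (-1))
    (hadm.integrableOn one_pos (y := 1) (by norm_num) 1)
  have hloop : leftLoopIntegral F (-1) 1 1 = 2 * Real.pi * I := by
    unfold leftLoopIntegral
    linear_combination i1 - i2 + hstrip + hrect + hinv + e1 - e2 + I * e3 - I * e4
  unfold hankel
  rw [← hF, hloop, inv_mul_cancel₀]
  simp [Real.pi_ne_zero]

lemma one_le_norm_add_mul_I {y : ℝ} (hy : |y| = 1) (u : ℝ) : 1 ≤ ‖(u : ℂ) + y * I‖ := by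
  have := abs_im_le_norm ((u : ℂ) + y * I)
  simpa [hy] using this

/-- Dominated convergence: |w| ≥ 1 on the loop, so |w^{-(μ+1)}| ≤ 1 for every μ ≥ 0. -/
lemma tendsto_hankel_one_add : Tendsto (fun μ : ℝ => hankel (μ + 1)) (𝓝[≥] 0) (𝓝 1) := by
  rw [← hankel_one]
  refine Tendsto.const_mul _ ?_
  have hb : ∀ μ : ℝ, 0 ≤ μ → ∀ w : ℂ, 1 ≤ ‖w‖ → ‖powExp (μ + 1) 1 w‖ ≤ Real.exp (1 * w.re) := by
    intro μ hμ w hw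
    have := norm_cpow_neg_ofReal_le (add_nonneg hμ zero_le_one) one_pos hw
    rw [Real.one_rpow] at this
    rw [powExp, norm_mul, norm_exp_ofReal_mul]
    exact mul_le_of_le_one_left (Real.exp_nonneg _) this
  have hC : (1 : ℝ) ≤ Real.exp 1 := Real.one_le_exp zero_le_one
  refine tendsto_leftLoopIntegral (t := 1) (C := Real.exp 1) one_pos one_pos ?_ ?_ ?_ ?_ ?_ one_pos
  · filter_upwards [self_mem_nhdsWithin] with μ hμ
    have h := loopAdmissible_powExp (add_nonneg hμ zero_le_one) 1
    refine ⟨fun y hy => ?_, h.continuous_vertical one_pos⟩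
    refine h.diff.continuousOn.comp_continuous (by fun_prop) fun u => Or.inr ?_
    simpa using hy
  · filter_upwards [self_mem_nhdsWithin] with μ hμ u _
    refine (hb μ hμ _ (one_le_norm_add_mul_I (by simp) u)).trans ?_
    refine le_trans (le_of_eq ?_) (le_mul_of_one_le_left (Real.exp_nonneg _) hC)
    simp
  · filter_upwards [self_mem_nhdsWithin] with μ hμ u _
    refine (hb μ hμ _ (one_le_norm_add_mul_I (by simp) u)).trans ?_
    refine le_trans (le_of_eq ?_) (le_mul_of_one_le_left (Real.exp_nonneg _) hC)
    simp
  · filter_upwards [self_mem_nhdsWithin] with μ hμ y _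
    refine (hb μ hμ _ ?_).trans (by simp)
    have := abs_re_le_norm (((1 : ℝ) : ℂ) + y * I)
    simpa using this
  · intro w hw
    have hw0 := slitPlane_ne_zero hw
    have : ContinuousAt (fun μ : ℝ => powExp (μ + 1) 1 w) 0 := by
      unfold powExp
      refine ContinuousAt.mul ?_ continuousAt_const
      refine ContinuousAt.const_cpow ?_ (Or.inl hw0)
      exact (by fun_prop : Continuous fun μ : ℝ => -((μ + 1 : ℝ) : ℂ)).continuousAt
    simpa using this.tendsto.mono_left nhdsWithin_le_nhds

lemma powExp_eq_mul_powExp_one (μ : ℝ) {t : ℝ} (ht : 0 < t) (w : ℂ) :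
    powExp μ t w = ((t ^ μ : ℝ) : ℂ) * powExp μ 1 (t * w) := by
  unfold powExp
  rw [ofReal_one, one_mul, ← mul_assoc]
  congr 1
  -- At w = 0 both sides rest on the conventions for `0 ^ s`, which depend on whether the exponent
  -- vanishes.
  rcases eq_or_ne w 0 with rfl | hw
  · rcases eq_or_ne μ 0 with rfl | hμ
    · simp
    · simp [zero_cpow, hμ]
  · have htc : (t : ℂ) ≠ 0 := by exact_mod_cast ht.ne'
    rw [cpow_def_of_ne_zero hw, cpow_def_of_ne_zero (mul_ne_zero htc hw), log_ofReal_mul ht hw,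
      Real.rpow_def_of_pos ht, ofReal_exp, ← exp_add]
    congr 1
    push_cast
    ring

/-- The loop integral of `w ^ (-μ) * exp (t w)`. -/
lemma leftLoopIntegral_powExp {μ t : ℝ} (ht : 0 < t) :
    (2 * Real.pi * I)⁻¹ * leftLoopIntegral (powExp μ t) (-t⁻¹) t⁻¹ t⁻¹
      = ((t ^ (μ - 1) : ℝ) : ℂ) * hankel μ := by
  have h1 : powExp μ t = fun w => ((t ^ μ : ℝ) : ℂ) * powExp μ 1 (t * w) :=
    funext (powExp_eq_mul_powExp_one μ ht)
  rw [h1, leftLoopIntegral_const_mul, leftLoopIntegral_comp_mul _ ht, mul_neg,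
    mul_inv_cancel₀ ht.ne', Real.rpow_sub_one ht.ne']
  unfold hankel
  push_cast
  ring

/-! ### Regularity of the gamma ratio in the variable and the parameters -/

/-- The parameters with `a ≥ 0` and `μ ≥ 0`. -/
def closedParamSet (p q : ℕ) : Set ((Fin p → ℝ) × (Fin q → ℝ)) :=
  {P | (∀ k, 0 ≤ P.1 k) ∧ 0 ≤ mu P.1 P.2}

lemma continuous_mu : Continuous fun P : (Fin p → ℝ) × (Fin q → ℝ) => mu P.1 P.2 := by
  unfold mu; fun_prop

lemma isClosed_closedParamSet : IsClosed (closedParamSet p q) := by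
  have h1 : IsClosed {P : (Fin p → ℝ) × (Fin q → ℝ) | ∀ k, 0 ≤ P.1 k} := by
    simp only [Set.ofPred_forall]
    exact isClosed_iInter fun k => isClosed_le continuous_const (by fun_prop)
  exact h1.inter (isClosed_le continuous_const continuous_mu)

lemma paramSet_subset : paramSet p q ⊆ closedParamSet p q := fun _ h => ⟨h.1, h.2.le⟩

lemma nu_pos {A : Fin p → ℝ} {B : Fin q → ℝ} (hA : ∀ k, 0 < A k) (hB : ∀ j, 0 < B j)
    (a : Fin p → ℝ) (b : Fin q → ℝ) : 0 < nu A a B b := by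
  rw [nu_eq_exp hA hB]; exact Real.exp_pos _

lemma continuous_nu {A : Fin p → ℝ} {B : Fin q → ℝ} (hA : ∀ k, 0 < A k) (hB : ∀ j, 0 < B j) :
    Continuous fun P : (Fin p → ℝ) × (Fin q → ℝ) => nu A P.1 B P.2 := by
  simp_rw [nu_eq_exp hA hB]; fun_prop

/-- The role of a ≥ 0: all poles lie on (-∞, 0], so one slit plane, and hence one loop, serves all
parameters. -/
lemma mul_add_mem_slitPlane {α β : ℝ} (hα : 0 < α) (hβ : 0 ≤ β) {w : ℂ} (hw : w ∈ slitPlane) :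
    (α : ℂ) * w + β ∈ slitPlane := by
  rcases hw with h | h
  · left
    simp only [add_re, re_ofReal_mul, ofReal_re]
    positivity
  · right
    simpa using ⟨hα.ne', h⟩

lemma differentiableAt_Gamma_of_mem_slitPlane {s : ℂ} (hs : s ∈ slitPlane) :
    DifferentiableAt ℂ Gamma s := by
  refine differentiableAt_Gamma s fun m hm => ?_
  rw [hm] at hs
  rcases hs with h | h
  · simp at h
    linarith [(m.cast_nonneg : (0 : ℝ) ≤ m)]
  · simp at h

lemma gammaRatio_eq_mul (A a : Fin p → ℝ) (B b : Fin q → ℝ) (s : ℂ) :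
    gammaRatio A a B b s = (∏ k, Gamma (A k * s + a k)) * ∏ j, (Gamma (B j * s + b j))⁻¹ := by
  rw [gammaRatio, div_eq_mul_inv, Finset.prod_inv_distrib]

lemma continuousOn_normRatio {A : Fin p → ℝ} (B : Fin q → ℝ) (hA : ∀ k, 0 < A k) :
    ContinuousOn (fun x : ((Fin p → ℝ) × (Fin q → ℝ)) × ℂ => normRatio A x.1.1 B x.1.2 x.2)
      (closedParamSet p q ×ˢ slitPlane) := by
  unfold normRatio
  simp_rw [gammaRatio_eq_mul]
  refine ContinuousOn.mul (ContinuousOn.mul ?_ ?_) (by fun_prop)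
  · refine continuousOn_finsetProd _ fun k _ x hx => ?_
    have h1 := differentiableAt_Gamma_of_mem_slitPlane
      (mul_add_mem_slitPlane (hA k) (hx.1.1 k) hx.2)
    have h2 : Continuous fun x : ((Fin p → ℝ) × (Fin q → ℝ)) × ℂ =>
      (A k : ℂ) * x.2 + (x.1.1 k : ℂ) := by fun_prop
    exact (ContinuousAt.comp (f := fun x : ((Fin p → ℝ) × (Fin q → ℝ)) × ℂ =>
      (A k : ℂ) * x.2 + (x.1.1 k : ℂ)) h1.continuousAt h2.continuousAt).continuousWithinAt
  · refine continuousOn_finsetProd _ fun j _ => Continuous.continuousOn ?_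
    exact differentiable_one_div_Gamma.continuous.comp (by fun_prop)

lemma differentiableOn_normRatio {A a : Fin p → ℝ} (B b : Fin q → ℝ) (hA : ∀ k, 0 < A k)
    (ha : ∀ k, 0 ≤ a k) : DifferentiableOn ℂ (normRatio A a B b) slitPlane := by
  intro w hw
  refine DifferentiableAt.differentiableWithinAt ?_
  unfold normRatio
  simp_rw [gammaRatio_eq_mul]
  refine DifferentiableAt.mul (DifferentiableAt.mul ?_ ?_) (by fun_prop)
  · refine DifferentiableAt.fun_finsetProd fun k _ => ?_
    have h1 := differentiableAt_Gamma_of_mem_slitPlane (mul_add_mem_slitPlane (hA k) (ha k) hw)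
    exact h1.comp w (f := fun w : ℂ => (A k : ℂ) * w + (a k : ℂ)) (by fun_prop)
  · refine DifferentiableAt.fun_finsetProd fun j _ => ?_
    exact (differentiable_one_div_Gamma _).comp w (f := fun w : ℂ => (B j : ℂ) * w + (b j : ℂ))
      (by fun_prop)

/-- The Mellin-Barnes integrand in the variable `t = log (ρ / x)`. -/
noncomputable def logIntegrand (A a : Fin p → ℝ) (B b : Fin q → ℝ) (t : ℝ) (w : ℂ) : ℂ :=
  normRatio A a B b w * exp (t * w)

lemma integrand_eq_logIntegrand {A : Fin p → ℝ} {B : Fin q → ℝ} (hA : ∀ k, 0 < A k)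
    (hB : ∀ j, 0 < B j) (a : Fin p → ℝ) (b : Fin q → ℝ) (t : ℝ) :
    integrand A a B b (rho A B * Real.exp (-t)) = logIntegrand A a B b t := by
  funext w
  have hρ := rho_pos hA hB
  have hx : 0 < rho A B * Real.exp (-t) := by positivity
  unfold integrand logIntegrand normRatio
  rw [cpow_def_of_ne_zero (by exact_mod_cast hx.ne'), mul_assoc, ← exp_add, ← ofReal_log hx.le,
    Real.log_mul hρ.ne' (Real.exp_ne_zero _), Real.log_exp]
  congr 2
  push_cast
  ring

/-! ### Uniform estimates for the Fox function -/

section Estimates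

variable {A : Fin p → ℝ} {B : Fin q → ℝ}

lemma norm_normRatio_le (hA : ∀ k, 0 < A k) (hB : ∀ j, 0 < B j) (hΔ : Delta A B = 0)
    {P : (Fin p → ℝ) × (Fin q → ℝ)} (hP : 0 ≤ mu P.1 P.2) {M R : ℝ} (hM : ‖P‖ ≤ M) (hR : 0 < R)
    {w : ℂ} (hw : R ≤ |w.im|) :
    ‖normRatio A P.1 B P.2 w‖
      ≤ nu A P.1 B P.2 * R ^ (-mu P.1 P.2) * Real.exp (errorConst A B M / R) := by
  obtain ⟨E, hE, h⟩ := exists_normRatio_eq hA hB hΔ (a := P.1) (b := P.2) (M := M) (R := R)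
    (fun k => ((norm_le_pi_norm P.1 k).trans (norm_fst_le P)).trans hM)
    (fun j => ((norm_le_pi_norm P.2 j).trans (norm_snd_le P)).trans hM) hR (Or.inl hw)
  have hν := nu_pos hA hB P.1 P.2
  rw [h, norm_mul, norm_mul, norm_real, Real.norm_of_nonneg hν.le]
  have h1 := norm_cpow_neg_ofReal_le hP hR (hw.trans (abs_im_le_norm w))
  have h2 : ‖exp E‖ ≤ Real.exp (errorConst A B M / R) :=
    (norm_exp_le_exp_norm E).trans (Real.exp_le_exp.mpr hE)
  gcongr

lemma loopAdmissible_logIntegrand (hA : ∀ k, 0 < A k) (hB : ∀ j, 0 < B j) (hΔ : Delta A B = 0)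
    {P : (Fin p → ℝ) × (Fin q → ℝ)} (hP : P ∈ closedParamSet p q) (t : ℝ) :
    LoopAdmissible (logIntegrand A P.1 B P.2 t) t where
  diff := (differentiableOn_normRatio B P.2 hA hP.1).mul (by fun_prop)
  bound δ hδ := by
    refine ⟨nu A P.1 B P.2 * δ ^ (-mu P.1 P.2) * Real.exp (errorConst A B ‖P‖ / δ),
      fun w hw => ?_⟩
    rw [logIntegrand, norm_mul, norm_exp_ofReal_mul]
    exact mul_le_mul_of_nonneg_right (norm_normRatio_le hA hB hΔ hP.2 le_rfl hδ hw)
      (Real.exp_nonneg _)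

lemma abscissa_pos (hA : ∀ k, 0 < A k) (a : Fin p → ℝ) : 0 < abscissa A a :=
  add_pos_of_pos_of_nonneg one_pos
    (Finset.sum_nonneg fun k _ => div_nonneg (abs_nonneg _) (hA k).le)

/-- The Fox function in the variable `t = log (ρ / x)` as an integral over any left loop. -/
lemma foxHComplex_eq (hA : ∀ k, 0 < A k) (hB : ∀ j, 0 < B j) (hΔ : Delta A B = 0)
    {P : (Fin p → ℝ) × (Fin q → ℝ)} (hP : P ∈ closedParamSet p q) {t φ c : ℝ} (ht : 0 < t)
    (hφ : 0 < φ) (hc : 0 < c) :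
    foxHComplex A P.1 B P.2 (rho A B * Real.exp (-t))
      = (2 * Real.pi * I)⁻¹ * leftLoopIntegral (logIntegrand A P.1 B P.2 t) (-φ) φ c := by
  rw [foxHComplex, integrand_eq_logIntegrand hA hB,
    (loopAdmissible_logIntegrand hA hB hΔ hP t).leftLoopIntegral_eq ht one_pos hφ
      (abscissa_pos hA P.1) hc]

lemma isCompact_closedParamSet_inter (p q : ℕ) (M : ℝ) :
    IsCompact (Metric.closedBall 0 M ∩ closedParamSet p q) :=
  (isCompact_closedBall _ _).inter_right isClosed_closedParamSet

lemma exists_nu_le (hA : ∀ k, 0 < A k) (hB : ∀ j, 0 < B j) (M : ℝ) :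
    ∃ N : ℝ, 0 ≤ N ∧ ∀ P ∈ closedParamSet p q, ‖P‖ ≤ M → nu A P.1 B P.2 ≤ N := by
  obtain ⟨N, hN⟩ := (isCompact_closedParamSet_inter p q M).exists_bound_of_continuousOn
    (continuous_nu hA hB).continuousOn
  refine ⟨|N|, abs_nonneg N, fun P hP hPM => ?_⟩
  exact ((le_abs_self _).trans (hN P ⟨by simpa using hPM, hP⟩)).trans (le_abs_self N)

lemma norm_two_pi_I_inv_le : ‖(2 * Real.pi * I : ℂ)⁻¹‖ ≤ 1 := by
  rw [norm_inv]
  refine inv_le_one_of_one_le₀ ?_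
  simp only [norm_mul, norm_ofNat, norm_real, norm_I, mul_one, Real.norm_of_nonneg Real.pi_pos.le]
  linarith [Real.pi_gt_three]

/-- Uniform bounds for the normalised gamma ratio on the loop with corners `1/2 ± i`. -/
lemma exists_normRatio_bound (hA : ∀ k, 0 < A k) (hB : ∀ j, 0 < B j) (hΔ : Delta A B = 0)
    (M : ℝ) : ∃ C : ℝ, 0 ≤ C ∧ ∀ P ∈ closedParamSet p q, ‖P‖ ≤ M →
      (∀ w : ℂ, |w.im| = 1 → ‖normRatio A P.1 B P.2 w‖ ≤ C) ∧
      ∀ y : ℝ, |y| ≤ 1 → ‖normRatio A P.1 B P.2 ((1 / 2 : ℝ) + y * I)‖ ≤ C := by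
  obtain ⟨N, hN0, hN⟩ := exists_nu_le hA hB M
  obtain ⟨D, hD⟩ := ((isCompact_closedParamSet_inter p q M).prod
    (isCompact_Icc (a := (-1 : ℝ)) (b := 1))).exists_bound_of_continuousOn
    (f := fun x => normRatio A x.1.1 B x.1.2 ((1 / 2 : ℝ) + x.2 * I))
    ((continuousOn_normRatio B hA).comp
      (f := fun x : ((Fin p → ℝ) × (Fin q → ℝ)) × ℝ => (x.1, (((1 / 2 : ℝ) : ℂ) + x.2 * I)))
      (by fun_prop) (fun x hx => ⟨hx.1.2, Or.inl (by simp)⟩))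
  refine ⟨max (N * Real.exp (errorConst A B M / 1)) D, le_max_of_le_left (by positivity),
    fun P hP hPM => ⟨fun w hw => ?_, fun y hy => ?_⟩⟩
  · refine le_max_of_le_left ?_
    refine (norm_normRatio_le hA hB hΔ hP.2 hPM one_pos hw.ge).trans ?_
    rw [Real.one_rpow, mul_one]
    gcongr
    exact hN P hP hPM
  · exact le_max_of_le_right (hD (P, y) ⟨⟨by simpa using hPM, hP⟩, abs_le.mp hy⟩)

/-- Bound for the Fox function away from `x = ρ`. -/
lemma exists_norm_foxHComplex_le (hA : ∀ k, 0 < A k) (hB : ∀ j, 0 < B j) (hΔ : Delta A B = 0)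
    (M : ℝ) : ∃ C : ℝ, 0 ≤ C ∧ ∀ P ∈ closedParamSet p q, ‖P‖ ≤ M → ∀ t : ℝ, 0 < t →
      ‖foxHComplex A P.1 B P.2 (rho A B * Real.exp (-t))‖
        ≤ C * (1 / t + 1) * Real.exp (t / 2) := by
  obtain ⟨C, hC0, hC⟩ := exists_normRatio_bound hA hB hΔ M
  refine ⟨2 * C, by positivity, fun P hP hPM t ht => ?_⟩
  obtain ⟨h1, h2⟩ := hC P hP hPM
  -- The abscissa 1/2 gives growth e^{t/2}; any value in (0, 1) would leave integrability against
  -- e^{-t} dt at infinity.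
  rw [foxHComplex_eq hA hB hΔ hP ht one_pos (c := 1 / 2) (by norm_num), norm_mul]
  refine (mul_le_of_le_one_left (norm_nonneg _) norm_two_pi_I_inv_le).trans ?_
  have hhor : ∀ y : ℝ, |y| = 1 → ∀ u : ℝ, u ≤ 1 / 2 →
      ‖logIntegrand A P.1 B P.2 t (u + y * I)‖ ≤ C * Real.exp (t * u) := by
    intro y hy u _
    rw [logIntegrand, norm_mul, norm_exp_ofReal_mul]
    have h3 := h1 (u + y * I) (by simpa using hy)
    simpa using mul_le_mul_of_nonneg_right h3 (Real.exp_nonneg (t * (u + y * I : ℂ).re))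
  refine (norm_leftLoopIntegral_le (C := C) (C' := C * Real.exp (t / 2)) ht one_pos
    (hhor _ (by simp)) (hhor _ (by simp)) fun y hy => ?_).trans (le_of_eq ?_)
  · rw [logIntegrand, norm_mul, norm_exp_ofReal_mul]
    refine mul_le_mul (h2 y hy) (le_of_eq ?_) (Real.exp_nonneg _) hC0
    congr 1
    simp; ring
  · rw [show t * (1 / 2) = t / 2 by ring]
    field_simp

/-- Behaviour of the Fox function near `x = ρ`. -/
lemma exists_norm_foxHComplex_sub_le (hA : ∀ k, 0 < A k) (hB : ∀ j, 0 < B j)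
    (hΔ : Delta A B = 0) {M : ℝ} (hM : 0 ≤ M) :
    ∃ C T : ℝ, 0 ≤ C ∧ 0 < T ∧ ∀ P ∈ closedParamSet p q, ‖P‖ ≤ M → ∀ t : ℝ, 0 < t → t ≤ T →
      ‖foxHComplex A P.1 B P.2 (rho A B * Real.exp (-t))
        - nu A P.1 B P.2 * (t ^ (mu P.1 P.2 - 1) : ℝ) * hankel (mu P.1 P.2)‖ ≤ C := by
  obtain ⟨N, hN0, hN⟩ := exists_nu_le hA hB M
  set K := errorConst A B M with hK
  have hK0 : 0 ≤ K := errorConst_nonneg hA hB hM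
  set D : ℝ := N * (K * Real.exp K) with hD
  have hD0 : 0 ≤ D := by positivity
  -- For R ≥ R₀ the sums ensure 2M ≤ A k * R and 2M ≤ B j * R, as the asymptotics require; the
  -- summand 1 ensures t ≤ 1 and |w| ≥ 1 on the loop.
  set R₀ : ℝ := 1 + ∑ k, 2 * M / A k + ∑ j, 2 * M / B j with hR₀
  have hs1 : ∀ k, 0 ≤ 2 * M / A k := fun k => by have := hA k; positivity
  have hs2 : ∀ j, 0 ≤ 2 * M / B j := fun j => by have := hB j; positivity
  have hS1 : 0 ≤ ∑ k, 2 * M / A k := Finset.sum_nonneg fun k _ => hs1 k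
  have hS2 : 0 ≤ ∑ j, 2 * M / B j := Finset.sum_nonneg fun j _ => hs2 j
  have hR₀1 : 1 ≤ R₀ := by linarith
  refine ⟨4 * D * Real.exp 1, R₀⁻¹, by positivity, by positivity, fun P hP hPM t ht htT => ?_⟩
  -- At this scale e^{tw} is of order 1 at the right side of the loop and the Stirling error is
  -- O(t).
  set R := t⁻¹ with hR
  have hR0 : 0 < R := by positivity
  have htR : t * R = 1 := mul_inv_cancel₀ ht.ne'
  have hRR : R₀ ≤ R := by
    rw [hR]; exact (le_inv_comm₀ ht (by positivity)).mp htT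
  have hRA : ∀ k, 2 * M ≤ A k * R := by
    intro k
    have h1 := Finset.single_le_sum (fun k _ => hs1 k) (Finset.mem_univ k)
    have h2 : 2 * M / A k ≤ R := by linarith
    rwa [div_le_iff₀ (hA k), mul_comm R] at h2
  have hRB : ∀ j, 2 * M ≤ B j * R := by
    intro j
    have h1 := Finset.single_le_sum (fun j _ => hs2 j) (Finset.mem_univ j)
    have h2 : 2 * M / B j ≤ R := by linarith
    rwa [div_le_iff₀ (hB j), mul_comm R] at h2
  have hν := nu_pos hA hB P.1 P.2
  have hfar : ∀ w : ℂ, w ∈ farRegion R → ‖logIntegrand A P.1 B P.2 t w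
      - nu A P.1 B P.2 * powExp (mu P.1 P.2) t w‖ ≤ D * t * Real.exp (t * w.re) := by
    intro w hw
    obtain ⟨E, hE, h⟩ := exists_normRatio_eq hA hB hΔ (a := P.1) (b := P.2) (M := M) (R := R)
      (fun k => ((norm_le_pi_norm P.1 k).trans (norm_fst_le P)).trans hPM)
      (fun j => ((norm_le_pi_norm P.2 j).trans (norm_snd_le P)).trans hPM) hR0 (w := w)
      (by
        rcases hw with h | h
        · exact Or.inr ⟨h, hRA, hRB⟩
        · exact Or.inl h)
    have hEt : ‖E‖ ≤ K * t := by rwa [hR, div_inv_eq_mul] at hE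
    have ht1 : t ≤ 1 := htT.trans (inv_le_one_of_one_le₀ hR₀1)
    have hEK : ‖E‖ ≤ K := hEt.trans (mul_le_of_le_one_right hK0 ht1)
    have hexp : ‖exp E - 1‖ ≤ K * t * Real.exp K := by
      have := norm_exp_sub_sum_le_norm_mul_exp E 1
      simp only [Finset.range_one, Finset.sum_singleton, pow_zero, Nat.factorial_zero, Nat.cast_one,
        div_one, pow_one] at this
      refine this.trans ?_
      gcongr
    have hpow : ‖w ^ (-(mu P.1 P.2 : ℂ))‖ ≤ 1 := by
      have := norm_cpow_neg_ofReal_le hP.2 one_pos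
        ((hR₀1.trans hRR).trans (le_norm_of_mem_farRegion hw))
      rwa [Real.one_rpow] at this
    have hsplit : logIntegrand A P.1 B P.2 t w - nu A P.1 B P.2 * powExp (mu P.1 P.2) t w
        = nu A P.1 B P.2 * w ^ (-(mu P.1 P.2 : ℂ)) * (exp E - 1) * exp (t * w) := by
      rw [logIntegrand, h, powExp]; ring
    rw [hsplit, norm_mul, norm_mul, norm_mul, norm_exp_ofReal_mul, norm_real,
      Real.norm_of_nonneg hν.le]
    refine mul_le_mul_of_nonneg_right ?_ (Real.exp_nonneg _)
    calc _ ≤ N * 1 * (K * t * Real.exp K) := by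
          gcongr
          exact hN P hP hPM
      _ = D * t := by rw [hD]; ring
  have hadm := loopAdmissible_logIntegrand hA hB hΔ hP t
  have hadm' := (loopAdmissible_powExp hP.2 t).const_mul (nu A P.1 B P.2)
  have hmain : foxHComplex A P.1 B P.2 (rho A B * Real.exp (-t))
        - nu A P.1 B P.2 * (t ^ (mu P.1 P.2 - 1) : ℝ) * hankel (mu P.1 P.2)
      = (2 * Real.pi * I)⁻¹ * leftLoopIntegral (fun w => logIntegrand A P.1 B P.2 t w
          - nu A P.1 B P.2 * powExp (mu P.1 P.2) t w) (-R) R R := by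
    rw [hadm.leftLoopIntegral_sub hadm' ht hR0 hR0, leftLoopIntegral_const_mul,
      foxHComplex_eq hA hB hΔ hP ht hR0 hR0]
    linear_combination (nu A P.1 B P.2 : ℂ) * leftLoopIntegral_powExp (μ := mu P.1 P.2) ht
  rw [hmain, norm_mul]
  refine (mul_le_of_le_one_left (norm_nonneg _) norm_two_pi_I_inv_le).trans ?_
  -- The rays give 2 · Dt · e/t and the side of length 2/t gives 2/t · Dt · e: the powers of t
  -- cancel.
  refine (norm_leftLoopIntegral_le (C := D * t) (C' := D * t * Real.exp 1) ht hR0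
    (fun u _ => ?_) (fun u _ => ?_) fun y _ => ?_).trans (le_of_eq ?_)
  · simpa using hfar (u + (-R : ℝ) * I) (Or.inr (by simp [abs_of_pos hR0]))
  · simpa using hfar (u + R * I) (Or.inr (by simp [abs_of_pos hR0]))
  · have := hfar (R + y * I) (Or.inl (by simp))
    simpa [htR] using this
  · rw [htR, hR]
    field_simp
    ring

end Estimates

lemma norm_hankel_le {μ : ℝ} (hμ : 0 ≤ μ) : ‖hankel μ‖ ≤ 4 * Real.exp 1 := by
  rw [hankel, norm_mul]
  refine (mul_le_of_le_one_left (norm_nonneg _) norm_two_pi_I_inv_le).trans ?_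
  have hb : ∀ w : ℂ, 1 ≤ ‖w‖ → ‖powExp μ 1 w‖ ≤ 1 * Real.exp (1 * w.re) := by
    intro w hw
    have := norm_cpow_neg_ofReal_le hμ one_pos hw
    rw [Real.one_rpow] at this
    rw [powExp, norm_mul, norm_exp_ofReal_mul]
    gcongr
  refine (norm_leftLoopIntegral_le (C := 1) (C' := Real.exp 1) one_pos one_pos
    (fun u _ => ?_) (fun u _ => ?_) fun y _ => ?_).trans (le_of_eq ?_)
  · simpa using hb _ (one_le_norm_add_mul_I (y := -1) (by simp) u)
  · simpa using hb _ (one_le_norm_add_mul_I (y := 1) (by simp) u)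
  · have h1 := abs_re_le_norm (((1 : ℝ) : ℂ) + y * I)
    have h2 := hb (((1 : ℝ) : ℂ) + y * I) (by simpa using h1)
    simpa using h2
  · rw [mul_one]; ring_nf

/-- Uniformity in μ ≤ m is the point: it lets the main term be absorbed into the e^{t/2} bound for
large t. -/
lemma exists_rpow_le_exp (m : ℝ) :
    ∃ C : ℝ, 0 ≤ C ∧ ∀ μ t : ℝ, 0 ≤ μ → μ ≤ m → 0 < t → t ^ μ ≤ C * Real.exp (t / 2) := by
  obtain ⟨n, hn⟩ := exists_nat_ge m
  set N : ℝ := 2 * (n + 1) with hN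
  have hN1 : 1 ≤ N := by have : (0 : ℝ) ≤ n := n.cast_nonneg; linarith
  refine ⟨N ^ (n + 1), by positivity, fun μ t hμ hμm ht => ?_⟩
  calc t ^ μ ≤ (1 + t) ^ μ := Real.rpow_le_rpow ht.le (by linarith) hμ
    _ ≤ (1 + t) ^ ((n + 1 : ℕ) : ℝ) :=
        Real.rpow_le_rpow_of_exponent_le (by linarith) (by push_cast; linarith)
    _ = (1 + t) ^ (n + 1) := Real.rpow_natCast _ _
    _ ≤ (N * Real.exp (t / N)) ^ (n + 1) := by
        have h1 := Real.add_one_le_exp (t / N)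
        have h2 : 1 + t ≤ N * (t / N + 1) := by
          rw [mul_add, mul_div_cancel₀ _ (by positivity)]; linarith
        have h3 : N * (t / N + 1) ≤ N * Real.exp (t / N) := by gcongr
        exact pow_le_pow_left₀ (by linarith) (h2.trans h3) _
    _ = N ^ (n + 1) * Real.exp (t / 2) := by
        rw [mul_pow, ← Real.exp_nat_mul]
        congr 2
        rw [hN]; push_cast
        field_simp

section UniformBounds

variable {A : Fin p → ℝ} {B : Fin q → ℝ}

/-- The Fox function is `ν * hankel μ * t ^ (μ - 1)` up to a remainder that is bounded uniformly in the
parameters; here `t = log (ρ / x)`. -/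
theorem exists_abs_foxH_sub_le (hA : ∀ k, 0 < A k) (hB : ∀ j, 0 < B j) (hΔ : Delta A B = 0)
    {M : ℝ} (hM : 0 ≤ M) :
    ∃ C : ℝ, 0 ≤ C ∧ ∀ P ∈ closedParamSet p q, ‖P‖ ≤ M → ∀ t : ℝ, 0 < t →
      |foxH A P.1 B P.2 (rho A B * Real.exp (-t))
        - nu A P.1 B P.2 * t ^ (mu P.1 P.2 - 1) * (hankel (mu P.1 P.2)).re|
        ≤ C * Real.exp (t / 2) := by
  obtain ⟨C₁, T, hC₁, hT, h₁⟩ := exists_norm_foxHComplex_sub_le hA hB hΔ hM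
  obtain ⟨C₂, hC₂, h₂⟩ := exists_norm_foxHComplex_le hA hB hΔ M
  obtain ⟨N, hN0, hN⟩ := exists_nu_le hA hB M
  obtain ⟨m, hm⟩ := (isCompact_closedParamSet_inter p q M).exists_bound_of_continuousOn
    continuous_mu.continuousOn
  obtain ⟨C₃, hC₃, h₃⟩ := exists_rpow_le_exp m
  refine ⟨C₁ + (C₂ * (1 / T + 1) + N * (C₃ / T) * (4 * Real.exp 1)), by positivity,
    fun P hP hPM t ht => ?_⟩
  set μ := mu P.1 P.2
  have hν := nu_pos hA hB P.1 P.2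
  have hre : foxH A P.1 B P.2 (rho A B * Real.exp (-t))
        - nu A P.1 B P.2 * t ^ (μ - 1) * (hankel μ).re
      = (foxHComplex A P.1 B P.2 (rho A B * Real.exp (-t))
        - nu A P.1 B P.2 * (t ^ (μ - 1) : ℝ) * hankel μ).re := by
    rw [sub_re, ← ofReal_mul, re_ofReal_mul]
    rfl
  rw [hre]
  refine (abs_re_le_norm _).trans ?_
  -- Below T the difference is small through cancellation; above T the function and its main term
  -- are bounded separately.
  rcases le_total t T with htT | htT
  · have h1 : 1 ≤ Real.exp (t / 2) := Real.one_le_exp (by positivity)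
    have h2 : 0 ≤ C₂ * (1 / T + 1) + N * (C₃ / T) * (4 * Real.exp 1) := by positivity
    refine (h₁ P hP hPM t ht htT).trans ?_
    nlinarith
  · have e1 : ‖foxHComplex A P.1 B P.2 (rho A B * Real.exp (-t))‖
        ≤ C₂ * (1 / T + 1) * Real.exp (t / 2) := by
      refine (h₂ P hP hPM t ht).trans ?_
      gcongr
    have e2 : t ^ (μ - 1) ≤ C₃ / T * Real.exp (t / 2) := by
      have h4 : μ ≤ m := (le_abs_self _).trans (hm P ⟨by simpa using hPM, hP⟩)
      rw [Real.rpow_sub_one ht.ne']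
      calc t ^ μ / t ≤ (C₃ * Real.exp (t / 2)) / T := by
            have := h₃ μ t hP.2 h4 ht
            gcongr
        _ = _ := by ring
    have e3 : ‖(nu A P.1 B P.2 : ℂ) * (t ^ (μ - 1) : ℝ) * hankel μ‖
        ≤ N * (C₃ / T * Real.exp (t / 2)) * (4 * Real.exp 1) := by
      rw [norm_mul, norm_mul, norm_real, norm_real, Real.norm_of_nonneg hν.le,
        Real.norm_of_nonneg (by positivity)]
      have h5 := norm_hankel_le hP.2
      have h6 := hN P hP hPM
      gcongr
    refine (norm_sub_le _ _).trans ((add_le_add e1 e3).trans ?_)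
    have h7 : 0 ≤ C₁ * Real.exp (t / 2) := by positivity
    linarith

/-- Dominated convergence on a fixed loop, valid for all nearby parameters and t. -/
lemma continuousOn_foxH (hA : ∀ k, 0 < A k) (hB : ∀ j, 0 < B j) (hΔ : Delta A B = 0) :
    ContinuousOn (fun x : ((Fin p → ℝ) × (Fin q → ℝ)) × ℝ =>
      foxH A x.1.1 B x.1.2 (rho A B * Real.exp (-x.2))) (closedParamSet p q ×ˢ Set.Ioi 0) := by
  rintro ⟨P₀, t₀⟩ ⟨hP₀, ht₀⟩
  simp only [Set.mem_Ioi] at ht₀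
  refine continuous_re.continuousAt.comp_continuousWithinAt ?_
  have heq : ∀ x ∈ closedParamSet p q ×ˢ Set.Ioi (0 : ℝ),
      foxHComplex A x.1.1 B x.1.2 (rho A B * Real.exp (-x.2))
        = (2 * Real.pi * I)⁻¹ * leftLoopIntegral (logIntegrand A x.1.1 B x.1.2 x.2) (-1) 1 (1 / 2) :=
    fun x hx => foxHComplex_eq hA hB hΔ hx.1 hx.2 one_pos (by norm_num)
  refine ContinuousWithinAt.congr (f := fun x : ((Fin p → ℝ) × (Fin q → ℝ)) × ℝ =>
    (2 * Real.pi * I : ℂ)⁻¹ * leftLoopIntegral (logIntegrand A x.1.1 B x.1.2 x.2) (-1) 1 (1 / 2))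
    ?_ heq (heq _ ⟨hP₀, ht₀⟩)
  refine Tendsto.const_mul _ ?_
  obtain ⟨C, hC0, hC⟩ := exists_normRatio_bound hA hB hΔ (‖P₀‖ + 1)
  have hnear : ∀ᶠ x : ((Fin p → ℝ) × (Fin q → ℝ)) × ℝ in
      𝓝[closedParamSet p q ×ˢ Set.Ioi 0] (P₀, t₀),
      x.1 ∈ closedParamSet p q ∧ ‖x.1‖ ≤ ‖P₀‖ + 1 ∧ t₀ / 2 < x.2 ∧ x.2 < 2 * t₀ := by
    have h1 : ∀ᶠ x : ((Fin p → ℝ) × (Fin q → ℝ)) × ℝ in 𝓝 (P₀, t₀), ‖x.1‖ < ‖P₀‖ + 1 :=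
      (by fun_prop : Continuous fun x : ((Fin p → ℝ) × (Fin q → ℝ)) × ℝ =>
        ‖x.1‖).continuousAt.eventually_lt_const (by simp)
    have h2 : ∀ᶠ x : ((Fin p → ℝ) × (Fin q → ℝ)) × ℝ in 𝓝 (P₀, t₀), t₀ / 2 < x.2 :=
      continuous_snd.continuousAt.eventually_const_lt (by simp; linarith)
    have h3 : ∀ᶠ x : ((Fin p → ℝ) × (Fin q → ℝ)) × ℝ in 𝓝 (P₀, t₀), x.2 < 2 * t₀ :=
      continuous_snd.continuousAt.eventually_lt_const (by simp; linarith)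
    filter_upwards [self_mem_nhdsWithin, h1.filter_mono nhdsWithin_le_nhds,
      h2.filter_mono nhdsWithin_le_nhds, h3.filter_mono nhdsWithin_le_nhds] with x h h1 h2 h3
    exact ⟨h.1, h1.le, h2, h3⟩
  -- With t₀/2 < t < 2t₀, the exponent tu is at most t₀u/2 for u ≤ 0 and at most t₀ for 0 ≤ u ≤ 1/2;
  -- the factor e^{t₀} covers the latter.
  have hhor : ∀ y : ℝ, |y| = 1 → ∀ᶠ x : ((Fin p → ℝ) × (Fin q → ℝ)) × ℝ in
      𝓝[closedParamSet p q ×ˢ Set.Ioi 0] (P₀, t₀), ∀ u : ℝ, u ≤ 1 / 2 →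
      ‖logIntegrand A x.1.1 B x.1.2 x.2 (u + y * I)‖
        ≤ C * Real.exp t₀ * Real.exp (t₀ / 2 * u) := by
    intro y hy
    filter_upwards [hnear] with x hx u hu
    rw [logIntegrand, norm_mul, norm_exp_ofReal_mul, mul_assoc, ← Real.exp_add]
    have h1 := (hC x.1 hx.1 hx.2.1).1 (u + y * I) (by simpa using hy)
    refine mul_le_mul h1 (Real.exp_le_exp.mpr ?_) (Real.exp_nonneg _) hC0
    have h2 : ((u : ℂ) + y * I).re = u := by simp
    rw [h2]
    nlinarith [hx.2.2.1, hx.2.2.2]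
  refine tendsto_leftLoopIntegral (t := t₀ / 2) (C := C * Real.exp t₀) (by positivity) one_pos
    ?_ (hhor _ (by simp)) (hhor _ (by simp)) ?_ ?_ (by norm_num)
  · filter_upwards [hnear] with x hx
    have h := loopAdmissible_logIntegrand hA hB hΔ hx.1 x.2
    refine ⟨fun y hy => ?_, h.continuous_vertical (by norm_num)⟩
    refine h.diff.continuousOn.comp_continuous (by fun_prop) fun u => Or.inr ?_
    simpa using hy
  · filter_upwards [hnear] with x hx y hy
    rw [logIntegrand, norm_mul, norm_exp_ofReal_mul]
    refine mul_le_mul ((hC x.1 hx.1 hx.2.1).2 y hy) (Real.exp_le_exp.mpr ?_) (Real.exp_nonneg _) hC0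
    have h2 : (((1 / 2 : ℝ) : ℂ) + y * I).re = 1 / 2 := by simp
    rw [h2]
    linarith [hx.2.2.2]
  · intro w hw
    have h1 := (continuousOn_normRatio B hA).comp (t := closedParamSet p q ×ˢ slitPlane)
      (s := closedParamSet p q ×ˢ Set.Ioi (0 : ℝ))
      (f := fun x : ((Fin p → ℝ) × (Fin q → ℝ)) × ℝ => (x.1, w)) (by fun_prop)
      (fun x hx => ⟨hx.1, hw⟩)
    have h2 : Continuous fun x : ((Fin p → ℝ) × (Fin q → ℝ)) × ℝ => exp ((x.2 : ℂ) * w) := by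
      fun_prop
    exact (h1.mul h2.continuousOn) (P₀, t₀) ⟨hP₀, ht₀⟩

end UniformBounds

/-! ### The approximate identity and the substitution x = r e^{-t} -/

/-- `μ t ^ (μ - 1)` is an approximate identity at `0` as `μ → 0`. -/
lemma tendsto_integral_mul_rpow_sub_one {g : ℝ → ℝ} {c : ℝ} (hg : IntegrableOn g (Set.Ioi 0))
    (hlim : Tendsto g (𝓝[>] 0) (𝓝 c)) :
    Tendsto (fun μ : ℝ => ∫ t in Set.Ioi 0, μ * t ^ (μ - 1) * g t) (𝓝[>] 0) (𝓝 c) := by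
  have hpos : ∀ᶠ μ : ℝ in 𝓝[>] 0, 0 < μ := self_mem_nhdsWithin
  refine tendsto_setIntegral_peak_smul_of_integrableOn_of_tendsto (x₀ := (0 : ℝ))
    (φ := fun μ t : ℝ => μ * t ^ (μ - 1)) measurableSet_Ioi (t := Set.Ioc 0 1) measurableSet_Ioc
    Set.Ioc_subset_Ioi_self (Ioc_mem_nhdsGT one_pos) (by simp) ?_ ?_ ?_ ?_ hg hlim
  · filter_upwards [hpos] with μ hμ t ht
    have : (0 : ℝ) < t := ht
    positivity
  · intro u hu h0
    obtain ⟨δ, hδ, hδu⟩ := Metric.isOpen_iff.mp hu 0 h0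
    rw [Metric.tendstoUniformlyOn_iff]
    intro ε hε
    have hlt : ∀ᶠ μ : ℝ in 𝓝[>] 0, μ < ε * min δ 1 :=
      nhdsWithin_le_nhds (eventually_lt_nhds (by positivity))
    have hlt1 : ∀ᶠ μ : ℝ in 𝓝[>] 0, μ < 1 := nhdsWithin_le_nhds (eventually_lt_nhds one_pos)
    filter_upwards [hpos, hlt, hlt1] with μ hμ h1 h2 t ht
    have ht0 : (0 : ℝ) < t := ht.1
    have htδ : δ ≤ t := by
      by_contra! h
      exact ht.2 (hδu (by simpa [abs_of_pos ht0] using h))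
    have hd : 0 < min δ 1 := by positivity
    -- The kernel decreases in t because μ < 1; taking the minimum with 1 makes the next bound free
    -- of μ.
    have h3 : t ^ (μ - 1) ≤ (min δ 1) ^ (μ - 1) :=
      Real.rpow_le_rpow_of_nonpos hd ((min_le_left _ _).trans htδ) (by linarith)
    have h4 : (min δ 1) ^ (μ - 1) ≤ (min δ 1)⁻¹ := by
      rw [← Real.rpow_neg_one]
      exact Real.rpow_le_rpow_of_exponent_ge hd (min_le_right _ _) (by linarith)
    have h5 : 0 < t ^ (μ - 1) := by positivity
    simp only [Pi.zero_apply, dist_zero_left, Real.norm_eq_abs]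
    rw [abs_of_pos (by positivity)]
    calc μ * t ^ (μ - 1) ≤ μ * (min δ 1)⁻¹ := by gcongr; exact h3.trans h4
      _ < ε * min δ 1 * (min δ 1)⁻¹ := by gcongr
      _ = ε := by field_simp
  -- The mass on (0, 1] is exactly 1 for every μ > 0.
  · refine tendsto_const_nhds.congr' ?_
    filter_upwards [hpos] with μ hμ
    rw [← intervalIntegral.integral_of_le zero_le_one, intervalIntegral.integral_const_mul,
      integral_rpow (Or.inl (by linarith))]
    simp [hμ.ne']
  · refine Eventually.of_forall fun μ => ?_
    exact (by fun_prop : Measurable fun t : ℝ => μ * t ^ (μ - 1)).aestronglyMeasurable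

lemma image_mul_exp_neg_Ioi {r : ℝ} (hr : 0 < r) :
    (fun t : ℝ => r * Real.exp (-t)) '' Set.Ioi 0 = Set.Ioo 0 r := by
  ext x
  constructor
  · rintro ⟨t, ht, rfl⟩
    have : Real.exp (-t) < 1 := Real.exp_zero ▸ Real.exp_lt_exp.mpr (by simpa using ht)
    exact ⟨by positivity, mul_lt_of_lt_one_right hr this⟩
  · rintro ⟨h0, h1⟩
    refine ⟨Real.log (r / x), Real.log_pos ((one_lt_div h0).mpr h1), ?_⟩
    simp only
    rw [Real.exp_neg, Real.exp_log (by positivity)]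
    field_simp

lemma hasDerivAt_mul_exp_neg (r t : ℝ) :
    HasDerivAt (fun t : ℝ => r * Real.exp (-t)) (-(r * Real.exp (-t))) t := by
  have := ((hasDerivAt_neg t).exp).const_mul r
  refine this.congr_deriv ?_
  ring

lemma injective_mul_exp_neg {r : ℝ} (hr : 0 < r) :
    Function.Injective fun t : ℝ => r * Real.exp (-t) := by
  intro s t h
  have := Real.exp_injective (mul_left_cancel₀ hr.ne' h)
  linarith

lemma integrableOn_Icc_iff_comp_exp_neg {r : ℝ} (hr : 0 < r) (g : ℝ → ℝ) :
    IntegrableOn g (Set.Icc 0 r) ↔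
      IntegrableOn (fun t => r * Real.exp (-t) * g (r * Real.exp (-t))) (Set.Ioi 0) := by
  rw [integrableOn_Icc_iff_integrableOn_Ioo, ← image_mul_exp_neg_Ioi hr,
    integrableOn_image_iff_integrableOn_abs_deriv_smul measurableSet_Ioi
      (fun t _ => (hasDerivAt_mul_exp_neg r t).hasDerivWithinAt) (injective_mul_exp_neg hr).injOn]
  refine integrableOn_congr_fun (fun t _ => ?_) measurableSet_Ioi
  simp only [abs_neg, smul_eq_mul]
  rw [abs_of_pos (by positivity)]

lemma integral_Icc_eq_integral_comp_exp_neg {r : ℝ} (hr : 0 < r) (g : ℝ → ℝ) :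
    ∫ x in Set.Icc 0 r, g x
      = ∫ t in Set.Ioi 0, r * Real.exp (-t) * g (r * Real.exp (-t)) := by
  rw [integral_Icc_eq_integral_Ioo, ← image_mul_exp_neg_Ioi hr,
    integral_image_eq_integral_abs_deriv_smul measurableSet_Ioi
      (fun t _ => (hasDerivAt_mul_exp_neg r t).hasDerivWithinAt) (injective_mul_exp_neg hr).injOn]
  refine setIntegral_congr_fun measurableSet_Ioi (fun t _ => ?_)
  simp only [abs_neg, smul_eq_mul]
  rw [abs_of_pos (by positivity)]

/-! ### Passage to the limit -/

section Limit

variable {A : Fin p → ℝ} {B : Fin q → ℝ}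

/-- The main term of the Fox function in the variable `t = log (ρ / x)`. -/
noncomputable def mainTerm (A : Fin p → ℝ) (B : Fin q → ℝ) (P : (Fin p → ℝ) × (Fin q → ℝ))
    (t : ℝ) : ℝ :=
  nu A P.1 B P.2 * t ^ (mu P.1 P.2 - 1) * (hankel (mu P.1 P.2)).re

/-- The Fox function minus its main term. -/
noncomputable def remainder (A : Fin p → ℝ) (B : Fin q → ℝ) (P : (Fin p → ℝ) × (Fin q → ℝ))
    (t : ℝ) : ℝ :=
  foxH A P.1 B P.2 (rho A B * Real.exp (-t)) - mainTerm A B P t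

lemma hankel_re_eq_mul {μ : ℝ} (hμ : 0 ≤ μ) : (hankel μ).re = μ * (hankel (μ + 1)).re := by
  rw [hankel_eq_mul hμ, Complex.re_ofReal_mul]

/-- The factor h(0) = 0 removes the non-integrable t^{-1}; this is why the function with μ = 0 is
still integrable up to ρ. -/
lemma mainTerm_eq_zero {P : (Fin p → ℝ) × (Fin q → ℝ)} (hP : mu P.1 P.2 = 0) (t : ℝ) :
    mainTerm A B P t = 0 := by
  simp [mainTerm, hP, hankel_zero]

lemma measurable_mainTerm (P : (Fin p → ℝ) × (Fin q → ℝ)) : Measurable (mainTerm A B P) := by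
  unfold mainTerm; fun_prop

lemma aestronglyMeasurable_remainder (hA : ∀ k, 0 < A k) (hB : ∀ j, 0 < B j)
    (hΔ : Delta A B = 0) {P : (Fin p → ℝ) × (Fin q → ℝ)} (hP : P ∈ closedParamSet p q) :
    AEStronglyMeasurable (remainder A B P) (volume.restrict (Set.Ioi 0)) := by
  refine AEStronglyMeasurable.sub ?_ (measurable_mainTerm P).aestronglyMeasurable
  refine ContinuousOn.aestronglyMeasurable ?_ measurableSet_Ioi
  exact (continuousOn_foxH hA hB hΔ).comp (f := fun t : ℝ => (P, t)) (by fun_prop)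
    (fun t ht => ⟨hP, ht⟩)

lemma integrableOn_exp_neg_mul_remainder (hA : ∀ k, 0 < A k) (hB : ∀ j, 0 < B j)
    (hΔ : Delta A B = 0) {P : (Fin p → ℝ) × (Fin q → ℝ)} (hP : P ∈ closedParamSet p q) :
    IntegrableOn (fun t => Real.exp (-t) * remainder A B P t) (Set.Ioi 0) := by
  obtain ⟨C, hC0, hC⟩ := exists_abs_foxH_sub_le hA hB hΔ (norm_nonneg P)
  refine Integrable.mono' ((integrableOn_exp_mul_Ioi (a := -1 / 2) (by norm_num) 0).const_mul C)
    ((by fun_prop : Measurable fun t : ℝ => Real.exp (-t)).aestronglyMeasurable.mul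
      (aestronglyMeasurable_remainder hA hB hΔ hP)) ?_
  filter_upwards [ae_restrict_mem measurableSet_Ioi] with t ht
  rw [norm_mul, Real.norm_of_nonneg (Real.exp_nonneg _)]
  calc _ ≤ Real.exp (-t) * (C * Real.exp (t / 2)) := by
        gcongr
        exact hC P hP le_rfl t ht
    _ = C * Real.exp (-1 / 2 * t) := by
        rw [mul_left_comm, ← Real.exp_add]; congr 2; ring

lemma integrableOn_exp_neg_mul_mainTerm {P : (Fin p → ℝ) × (Fin q → ℝ)} (hP : 0 ≤ mu P.1 P.2) :
    IntegrableOn (fun t => Real.exp (-t) * mainTerm A B P t) (Set.Ioi 0) := by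
  rcases hP.eq_or_lt with h | h
  · simp [mainTerm_eq_zero h.symm]
  · refine ((Real.GammaIntegral_convergent h).const_mul
      (nu A P.1 B P.2 * (hankel (mu P.1 P.2)).re)).congr ?_
    refine Eventually.of_forall fun t => ?_
    simp only [mainTerm]
    ring

lemma integrableOn_exp_neg_mul_foxH (hA : ∀ k, 0 < A k) (hB : ∀ j, 0 < B j)
    (hΔ : Delta A B = 0) {P : (Fin p → ℝ) × (Fin q → ℝ)} (hP : P ∈ closedParamSet p q) :
    IntegrableOn (fun t => Real.exp (-t) * foxH A P.1 B P.2 (rho A B * Real.exp (-t)))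
      (Set.Ioi 0) := by
  refine ((integrableOn_exp_neg_mul_remainder hA hB hΔ hP).add
    (integrableOn_exp_neg_mul_mainTerm (A := A) (B := B) hP.2)).congr (Eventually.of_forall fun t => ?_)
  simp only [remainder, Pi.add_apply]
  ring

/-- The Fox function is integrable on `[0, ρ]`. -/
theorem integrableOn_foxH (hA : ∀ k, 0 < A k) (hB : ∀ j, 0 < B j) (hΔ : Delta A B = 0)
    {P : (Fin p → ℝ) × (Fin q → ℝ)} (hP : P ∈ closedParamSet p q) :
    IntegrableOn (foxH A P.1 B P.2) (Set.Icc 0 (rho A B)) := by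
  rw [integrableOn_Icc_iff_comp_exp_neg (rho_pos hA hB)]
  refine ((integrableOn_exp_neg_mul_foxH hA hB hΔ hP).const_mul (rho A B)).congr
    (Eventually.of_forall fun t => ?_)
  simp only
  ring

variable {P₀ : (Fin p → ℝ) × (Fin q → ℝ)}

lemma tendsto_mu_nhdsGT (hμ : mu P₀.1 P₀.2 = 0) :
    Tendsto (fun P : (Fin p → ℝ) × (Fin q → ℝ) => mu P.1 P.2) (𝓝[paramSet p q] P₀) (𝓝[>] 0) := by
  refine tendsto_nhdsWithin_iff.mpr ⟨?_, ?_⟩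
  · have := (continuous_mu (p := p) (q := q)).tendsto P₀
    rw [hμ] at this
    exact this.mono_left nhdsWithin_le_nhds
  · filter_upwards [self_mem_nhdsWithin] with P hP using hP.2

lemma tendsto_hankel_re (hμ : mu P₀.1 P₀.2 = 0) :
    Tendsto (fun P : (Fin p → ℝ) × (Fin q → ℝ) => (hankel (mu P.1 P.2 + 1)).re)
      (𝓝[paramSet p q] P₀) (𝓝 1) := by
  have h1 := (Complex.continuous_re.tendsto _).comp (tendsto_hankel_one_add.mono_left
    (nhdsWithin_mono 0 Set.Ioi_subset_Ici_self))
  exact h1.comp (tendsto_mu_nhdsGT hμ)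

lemma tendsto_nu (hA : ∀ k, 0 < A k) (hB : ∀ j, 0 < B j) :
    Tendsto (fun P : (Fin p → ℝ) × (Fin q → ℝ) => nu A P.1 B P.2) (𝓝[paramSet p q] P₀)
      (𝓝 (nu A P₀.1 B P₀.2)) :=
  ((continuous_nu hA hB).tendsto P₀).mono_left nhdsWithin_le_nhds

lemma tendsto_mainTerm (hA : ∀ k, 0 < A k) (hB : ∀ j, 0 < B j) (hμ : mu P₀.1 P₀.2 = 0)
    {t : ℝ} (ht : 0 < t) :
    Tendsto (fun P => mainTerm A B P t) (𝓝[paramSet p q] P₀) (𝓝 0) := by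
  have h1 : Tendsto (fun P : (Fin p → ℝ) × (Fin q → ℝ) => mu P.1 P.2) (𝓝[paramSet p q] P₀)
      (𝓝 0) := (tendsto_mu_nhdsGT hμ).mono_right nhdsWithin_le_nhds
  have h2 : Tendsto (fun P : (Fin p → ℝ) × (Fin q → ℝ) => t ^ (mu P.1 P.2 - 1))
      (𝓝[paramSet p q] P₀) (𝓝 (t ^ ((0 : ℝ) - 1))) :=
    (Real.continuousAt_const_rpow ht.ne').tendsto.comp (h1.sub_const 1)
  have h3 := ((tendsto_nu (P₀ := P₀) hA hB).mul h2).mul (h1.mul (tendsto_hankel_re hμ))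
  rw [zero_mul, mul_zero] at h3
  refine h3.congr' ?_
  filter_upwards [self_mem_nhdsWithin] with P hP
  rw [mainTerm, hankel_re_eq_mul hP.2.le]

/-- Convergence of the integrals in the variable `t = log (ρ / x)`. -/
theorem tendsto_integral_mul_foxH (hA : ∀ k, 0 < A k) (hB : ∀ j, 0 < B j) (hΔ : Delta A B = 0)
    (hP₀ : P₀ ∈ closedParamSet p q) (hμ : mu P₀.1 P₀.2 = 0) {g : ℝ → ℝ} {D c : ℝ}
    (hg : Measurable g) (hgD : ∀ t, 0 < t → |g t| ≤ D * Real.exp (-t))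
    (hgc : Tendsto g (𝓝[>] 0) (𝓝 c)) :
    Tendsto (fun P : (Fin p → ℝ) × (Fin q → ℝ) =>
        ∫ t in Set.Ioi 0, g t * foxH A P.1 B P.2 (rho A B * Real.exp (-t)))
      (𝓝[paramSet p q] P₀)
      (𝓝 ((∫ t in Set.Ioi 0, g t * foxH A P₀.1 B P₀.2 (rho A B * Real.exp (-t)))
        + nu A P₀.1 B P₀.2 * c)) := by
  have hD : 0 ≤ D := by
    have := (abs_nonneg _).trans (hgD 1 one_pos)
    exact nonneg_of_mul_nonneg_left this (Real.exp_pos _)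
  have hdom : ∀ h : ℝ → ℝ, AEStronglyMeasurable h (volume.restrict (Set.Ioi 0)) →
      IntegrableOn (fun t => Real.exp (-t) * h t) (Set.Ioi 0) →
      IntegrableOn (fun t => g t * h t) (Set.Ioi 0) := by
    intro h hm hi
    refine Integrable.mono' (hi.norm.const_mul D) (hg.aestronglyMeasurable.mul hm) ?_
    filter_upwards [ae_restrict_mem measurableSet_Ioi] with t ht
    rw [norm_mul, norm_mul, Real.norm_of_nonneg (Real.exp_nonneg _), ← mul_assoc]
    gcongr
    exact hgD t ht
  have hgi : IntegrableOn g (Set.Ioi 0) := by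
    refine (Integrable.mono' ((integrableOn_exp_neg_Ioi 0).const_mul D) hg.aestronglyMeasurable ?_)
    filter_upwards [ae_restrict_mem measurableSet_Ioi] with t ht using hgD t ht
  -- By the recurrence the main term is ν h(μ+1) times the approximate identity, which extracts the
  -- right limit c of g.
  have hmain : Tendsto (fun P => ∫ t in Set.Ioi 0, g t * mainTerm A B P t) (𝓝[paramSet p q] P₀)
      (𝓝 (nu A P₀.1 B P₀.2 * c)) := by
    have h1 := (tendsto_integral_mul_rpow_sub_one hgi hgc).comp (tendsto_mu_nhdsGT hμ)
    have h2 := ((tendsto_nu (P₀ := P₀) hA hB).mul (tendsto_hankel_re hμ)).mul h1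
    rw [mul_one] at h2
    refine h2.congr' ?_
    filter_upwards [self_mem_nhdsWithin] with P hP
    simp only [Function.comp_apply]
    rw [← integral_const_mul]
    refine integral_congr_ae (Eventually.of_forall fun t => ?_)
    simp only [mainTerm, hankel_re_eq_mul hP.2.le]
    ring
  -- The majorant is D e^{-t} · C e^{t/2}. Pointwise the main term dies out, so the limit is the Fox
  -- function itself.
  have hrem : Tendsto (fun P => ∫ t in Set.Ioi 0, g t * remainder A B P t) (𝓝[paramSet p q] P₀)
      (𝓝 (∫ t in Set.Ioi 0, g t * foxH A P₀.1 B P₀.2 (rho A B * Real.exp (-t)))) := by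
    obtain ⟨C, hC0, hC⟩ := exists_abs_foxH_sub_le hA hB hΔ (M := ‖P₀‖ + 1) (by positivity)
    have hnear : ∀ᶠ P in 𝓝[paramSet p q] P₀, ‖P‖ < ‖P₀‖ + 1 :=
      nhdsWithin_le_nhds (continuous_norm.continuousAt.eventually_lt_const (by simp))
    refine tendsto_integral_filter_of_dominated_convergence
      (fun t => D * C * Real.exp (-1 / 2 * t)) ?_ ?_
      ((integrableOn_exp_mul_Ioi (a := -1 / 2) (by norm_num) 0).const_mul (D * C)) ?_
    · filter_upwards [self_mem_nhdsWithin] with P hP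
      exact hg.aestronglyMeasurable.mul
        (aestronglyMeasurable_remainder hA hB hΔ (paramSet_subset hP))
    · filter_upwards [self_mem_nhdsWithin, hnear] with P hP hPn
      filter_upwards [ae_restrict_mem measurableSet_Ioi] with t ht
      rw [norm_mul]
      calc _ ≤ (D * Real.exp (-t)) * (C * Real.exp (t / 2)) := by
            gcongr
            · exact hgD t ht
            · exact hC P (paramSet_subset hP) hPn.le t ht
        _ = D * C * Real.exp (-1 / 2 * t) := by
            rw [mul_mul_mul_comm, ← Real.exp_add]; congr 2; ring
    · filter_upwards [ae_restrict_mem measurableSet_Ioi] with t ht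
      refine Tendsto.const_mul _ ?_
      have h1 : Tendsto (fun P : (Fin p → ℝ) × (Fin q → ℝ) =>
          foxH A P.1 B P.2 (rho A B * Real.exp (-t))) (𝓝[paramSet p q] P₀)
          (𝓝 (foxH A P₀.1 B P₀.2 (rho A B * Real.exp (-t)))) := by
        have h2 := (continuousOn_foxH hA hB hΔ).comp (s := closedParamSet p q)
          (f := fun P : (Fin p → ℝ) × (Fin q → ℝ) => (P, t)) (by fun_prop) (fun P hP => ⟨hP, ht⟩)
        exact (h2 P₀ hP₀).tendsto.mono_left (nhdsWithin_mono _ paramSet_subset)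
      simpa [remainder] using h1.sub (tendsto_mainTerm hA hB hμ ht)
  refine (hrem.add hmain).congr' ?_
  filter_upwards [self_mem_nhdsWithin] with P hP
  have hP' := paramSet_subset hP
  rw [← integral_add
    (hdom _ (aestronglyMeasurable_remainder hA hB hΔ hP')
      (integrableOn_exp_neg_mul_remainder hA hB hΔ hP'))
    (hdom _ (measurable_mainTerm P).aestronglyMeasurable
      (integrableOn_exp_neg_mul_mainTerm hP'.2))]
  refine integral_congr_ae (Eventually.of_forall fun t => ?_)
  simp only [remainder]
  ring

/-- Convergence of the integrals over `[η, ρ]` of continuous functions. -/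
theorem tendsto_setIntegral_mul_foxH (hA : ∀ k, 0 < A k) (hB : ∀ j, 0 < B j)
    (hΔ : Delta A B = 0) (hP₀ : P₀ ∈ closedParamSet p q) (hμ : mu P₀.1 P₀.2 = 0) {η : ℝ}
    (hη : 0 ≤ η) (hηρ : η < rho A B) {f : ℝ → ℝ} (hf : ContinuousOn f (Set.Icc η (rho A B))) :
    Tendsto (fun P : (Fin p → ℝ) × (Fin q → ℝ) =>
        ∫ x in Set.Icc η (rho A B), f x * foxH A P.1 B P.2 x)
      (𝓝[paramSet p q] P₀)
      (𝓝 ((∫ x in Set.Icc η (rho A B), f x * foxH A P₀.1 B P₀.2 x)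
        + nu A P₀.1 B P₀.2 * (rho A B * f (rho A B)))) := by
  set r := rho A B with hr
  have hr0 : 0 < r := rho_pos hA hB
  -- Extension by zero moves the integral to [0, ρ], hence to all of t > 0.
  set F : ℝ → ℝ := (Set.Icc η r).indicator f with hF
  set g : ℝ → ℝ := fun t => r * Real.exp (-t) * F (r * Real.exp (-t)) with hg
  have hFmeas : Measurable F := by
    refine measurable_of_restrict_of_restrict_compl (s := Set.Icc η r) measurableSet_Icc ?_ ?_
    · have : (Set.Icc η r).domRestrict F = (Set.Icc η r).domRestrict f := by
        ext x; exact Set.indicator_of_mem x.2 f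
      rw [this]
      exact (continuousOn_iff_continuous_domRestrict.mp hf).measurable
    · have : (Set.Icc η r)ᶜ.domRestrict F = fun _ => 0 := by
        ext x; exact Set.indicator_of_notMem x.2 f
      rw [this]
      exact measurable_const
  obtain ⟨D, hD⟩ := isCompact_Icc.exists_bound_of_continuousOn hf
  have hFD : ∀ x, |F x| ≤ |D| := by
    intro x
    by_cases hx : x ∈ Set.Icc η r
    · rw [hF, Set.indicator_of_mem hx]
      exact (hD x hx).trans (le_abs_self D)
    · rw [hF, Set.indicator_of_notMem hx]
      simp
  have heq : ∀ P : (Fin p → ℝ) × (Fin q → ℝ), ∫ x in Set.Icc η r, f x * foxH A P.1 B P.2 x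
      = ∫ t in Set.Ioi 0, g t * foxH A P.1 B P.2 (r * Real.exp (-t)) := by
    intro P
    have h1 : ∫ x in Set.Icc η r, f x * foxH A P.1 B P.2 x
        = ∫ x in Set.Icc 0 r, F x * foxH A P.1 B P.2 x := by
      have : (fun x => F x * foxH A P.1 B P.2 x)
          = (Set.Icc η r).indicator fun x => f x * foxH A P.1 B P.2 x := by
        ext x
        by_cases hx : x ∈ Set.Icc η r <;> simp [hF, hx]
      rw [this, setIntegral_indicator measurableSet_Icc,
        Set.inter_eq_self_of_subset_right (Set.Icc_subset_Icc_left hη)]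
    rw [h1, integral_Icc_eq_integral_comp_exp_neg hr0]
    refine integral_congr_ae (Eventually.of_forall fun t => ?_)
    simp only [hg]
    ring
  simp_rw [heq]
  refine tendsto_integral_mul_foxH hA hB hΔ hP₀ hμ (D := r * |D|) ?_ ?_ ?_
  · exact (by fun_prop : Measurable fun t : ℝ => r * Real.exp (-t)).mul
      (hFmeas.comp (by fun_prop))
  · intro t _
    rw [hg, abs_mul, abs_of_pos (by positivity)]
    have := hFD (r * Real.exp (-t))
    calc _ ≤ r * Real.exp (-t) * |D| := by gcongr
      _ = _ := by ring
  -- The right limit is ρ f(ρ), with ρ coming from the Jacobian. Since η < ρ, the point r e^{-t}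
  -- lies in [η, r] for small t and the indicator plays no role.
  · have h1 : Tendsto (fun t : ℝ => r * Real.exp (-t)) (𝓝[>] 0) (𝓝 r) := by
      have : ContinuousAt (fun t : ℝ => r * Real.exp (-t)) 0 := by fun_prop
      simpa using this.tendsto.mono_left nhdsWithin_le_nhds
    have h2 : ∀ᶠ t : ℝ in 𝓝[>] 0, r * Real.exp (-t) ∈ Set.Icc η r := by
      filter_upwards [h1.eventually_const_lt hηρ, self_mem_nhdsWithin] with t ht ht0
      refine ⟨ht.le, mul_le_of_le_one_right hr0.le (Real.exp_le_one_iff.mpr ?_)⟩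
      simpa using (le_of_lt ht0 : (0 : ℝ) ≤ t)
    have h3 := (hf r ⟨hηρ.le, le_rfl⟩).tendsto.comp (tendsto_nhdsWithin_iff.mpr ⟨h1, h2⟩)
    refine (h1.mul h3).congr' ?_
    filter_upwards [h2] with t ht
    simp only [hg, hF, Set.indicator_of_mem ht, Function.comp_apply]

end Limit

/-! ### Integration against signed measures -/

lemma integrable_variation_withDensityᵥ {α : Type*} [MeasurableSpace α] {m : Measure α}
    {h f : α → ℝ} (hh : Integrable h m) (hf : AEStronglyMeasurable f m) {C : ℝ}
    (hC : ∀ᵐ x ∂m, |f x| ≤ C) : (m.withDensityᵥ h).Integrable f := by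
  have : IsFiniteMeasure (m.withDensity fun x => ‖h x‖ₑ) := ⟨by simpa using! hh.2⟩
  rw [VectorMeasure.Integrable, Measure.variation_withDensityᵥ hh]
  exact Integrable.of_bound (hf.mono_ac (withDensity_absolutelyContinuous _ _)) C
    ((withDensity_absolutelyContinuous _ _).ae_le hC)

/-- Integration with respect to a signed measure with density. -/
lemma integral_withDensityᵥ {α : Type*} [MeasurableSpace α] {m : Measure α} {h f : α → ℝ}
    (hh : Integrable h m) (hf : AEStronglyMeasurable f m) {C : ℝ} (hC : ∀ᵐ x ∂m, |f x| ≤ C) :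
    (m.withDensityᵥ h).integral f (ContinuousLinearMap.lsmul ℝ ℝ) = ∫ x, f x * h x ∂m := by
  have hfin₁ := isFiniteMeasure_withDensity_ofReal hh.2
  have hfin₂ := isFiniteMeasure_withDensity_ofReal hh.neg.2
  -- Multiplication on ℝ is commutative; the flipped pairing is the form needed for
  -- `VectorMeasure.integral_toSignedMeasure`.
  have hflip : ContinuousLinearMap.lsmul ℝ ℝ = (ContinuousLinearMap.lsmul ℝ ℝ (E := ℝ)).flip := by
    ext; simp
  have hint : ∀ g : α → ℝ, Integrable g m → Integrable (fun x => max (g x) 0 * f x) m := by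
    intro g hg
    refine (hg.pos_part.bdd_mul (c := C) hf hC).congr (Eventually.of_forall fun x => ?_)
    simp only
    ring
  have hpart : ∀ g : α → ℝ, Integrable g m →
      ∫ x, f x ∂(m.withDensity fun x => ENNReal.ofReal (g x)) = ∫ x, max (g x) 0 * f x ∂m := by
    intro g hg
    rw [integral_withDensity_eq_integral_toReal_smul₀ hg.aemeasurable.ennreal_ofReal
      (Eventually.of_forall fun x => ENNReal.ofReal_lt_top)]
    refine integral_congr_ae (Eventually.of_forall fun x => ?_)
    simp [ENNReal.toReal_ofReal', smul_eq_mul]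
  rw [withDensityᵥ_eq_withDensity_pos_part_sub_withDensity_neg_part hh,
    VectorMeasure.integral_sub_vectorMeasure]
  · rw [hflip, VectorMeasure.integral_toSignedMeasure, VectorMeasure.integral_toSignedMeasure,
      hpart h hh, hpart (fun x => -h x) hh.neg, ← integral_sub (hint h hh) (hint (fun x => -h x) hh.neg)]
    refine integral_congr_ae (Eventually.of_forall fun x => ?_)
    simp only
    rw [← sub_mul, max_zero_sub_max_neg_zero_eq_self, mul_comm]
  · rw [VectorMeasure.Integrable, Measure.variation_toSignedMeasure]
    exact Integrable.of_bound (hf.mono_ac (withDensity_absolutelyContinuous _ _)) C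
      ((withDensity_absolutelyContinuous _ _).ae_le hC)
  · rw [VectorMeasure.Integrable, Measure.variation_toSignedMeasure]
    exact Integrable.of_bound (hf.mono_ac (withDensity_absolutelyContinuous _ _)) C
      ((withDensity_absolutelyContinuous _ _).ae_le hC)

lemma restrict_withDensityᵥ {α : Type*} [MeasurableSpace α] {m : Measure α} {h : α → ℝ}
    (hh : Integrable h m) {s : Set α} (hs : MeasurableSet s) :
    (m.withDensityᵥ h).restrict s = (m.restrict s).withDensityᵥ h := by
  ext t ht
  rw [VectorMeasure.restrict_apply _ hs ht, withDensityᵥ_apply hh (ht.inter hs),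
    withDensityᵥ_apply hh.integrableOn ht, Measure.restrict_restrict ht]

section SignedMeasures

variable {A a : Fin p → ℝ} {B b : Fin q → ℝ} {η : ℝ} {f : ℝ → ℝ}

lemma foxMeasure_restrict (hH : IntegrableOn (foxH A a B b) (Set.Icc 0 (rho A B))) (hη : 0 ≤ η) :
    (foxMeasure A a B b).restrict (Set.Icc η (rho A B))
      = (volume.restrict (Set.Icc η (rho A B))).withDensityᵥ (foxH A a B b) := by
  rw [foxMeasure, restrict_withDensityᵥ hH measurableSet_Icc,
    Measure.restrict_restrict measurableSet_Icc,
    Set.inter_eq_self_of_subset_left (Set.Icc_subset_Icc_left hη)]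

lemma integral_foxMeasure_restrict (hH : IntegrableOn (foxH A a B b) (Set.Icc 0 (rho A B)))
    (hη : 0 ≤ η) (hf : ContinuousOn f (Set.Icc η (rho A B))) :
    ((foxMeasure A a B b).restrict (Set.Icc η (rho A B))).Integrable f ∧
    ((foxMeasure A a B b).restrict (Set.Icc η (rho A B))).integral f
        (ContinuousLinearMap.lsmul ℝ ℝ)
      = ∫ x in Set.Icc η (rho A B), f x * foxH A a B b x := by
  obtain ⟨C, hC⟩ := isCompact_Icc.exists_bound_of_continuousOn hf
  have hH' := hH.mono_set (Set.Icc_subset_Icc_left hη)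
  have hfm := hf.aestronglyMeasurable (μ := volume) measurableSet_Icc
  have hb : ∀ᵐ x ∂volume.restrict (Set.Icc η (rho A B)), |f x| ≤ C := by
    filter_upwards [ae_restrict_mem measurableSet_Icc] with x hx using hC x hx
  rw [foxMeasure_restrict hH hη]
  exact ⟨integrable_variation_withDensityᵥ hH' hfm hb, integral_withDensityᵥ hH' hfm hb⟩

/-- The interval is closed at ρ, so restriction keeps the whole point mass. -/
lemma integral_limitMeasure_restrict (hH : IntegrableOn (foxH A a B b) (Set.Icc 0 (rho A B)))
    (hη : 0 ≤ η) (hηρ : η ≤ rho A B) (hf : ContinuousOn f (Set.Icc η (rho A B))) :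
    ((limitMeasure A a B b).restrict (Set.Icc η (rho A B))).integral f
        (ContinuousLinearMap.lsmul ℝ ℝ)
      = (∫ x in Set.Icc η (rho A B), f x * foxH A a B b x)
        + nu A a B b * (rho A B * f (rho A B)) := by
  obtain ⟨h1, h2⟩ := integral_foxMeasure_restrict hH hη hf
  rw [limitMeasure, VectorMeasure.restrict_add,
    VectorMeasure.restrict_dirac_of_mem measurableSet_Icc ⟨hηρ, le_rfl⟩,
    VectorMeasure.integral_add_vectorMeasure _ h1, h2, VectorMeasure.integral_dirac]
  · simp only [ContinuousLinearMap.lsmul_apply, smul_eq_mul]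
    ring
  · rw [VectorMeasure.Integrable, VectorMeasure.variation_dirac]
    exact (integrable_dirac (by simp)).smul_measure enorm_ne_top

end SignedMeasures

end FoxH

open FoxH in
theorem theorem3 {p q : ℕ} (A : Fin p → ℝ) (B : Fin q → ℝ)
    (hA : ∀ k, 0 < A k) (hB : ∀ j, 0 < B j) (hΔ : Delta A B = 0)
    (aStar : Fin p → ℝ) (bStar : Fin q → ℝ)
    (ha : ∀ k, 0 ≤ aStar k) (hμ : mu aStar bStar = 0) :
    -- all the measures involved are finite signed measures on `[0, ρ]`
    (∀ P ∈ paramSet p q,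
      MeasureTheory.IntegrableOn (foxH A P.1 B P.2) (Set.Icc 0 (rho A B))) ∧
    MeasureTheory.IntegrableOn (foxH A aStar B bStar) (Set.Icc 0 (rho A B)) ∧
    ∀ η : ℝ, 0 ≤ η → η < rho A B →
      -- weak convergence on `[η, ρ]`
      WeakConvergesOn (fun P : (Fin p → ℝ) × (Fin q → ℝ) => foxMeasure A P.1 B P.2)
        (nhdsWithin (aStar, bStar) (paramSet p q)) (limitMeasure A aStar B bStar) η (rho A B) ∧
      -- the resulting regularization of the integrals of the zero-balanced function
      ∀ f : ℝ → ℝ, ContinuousOn f (Set.Icc η (rho A B)) →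
        Filter.Tendsto
          (fun P : (Fin p → ℝ) × (Fin q → ℝ) =>
            (∫ x in Set.Icc η (rho A B), f x * foxH A P.1 B P.2 x)
              - nu A aStar B bStar * rho A B * f (rho A B))
          (nhdsWithin (aStar, bStar) (paramSet p q))
          (nhds (∫ x in Set.Icc η (rho A B), f x * foxH A aStar B bStar x)) := by
  have hP₀ : (aStar, bStar) ∈ closedParamSet p q := ⟨ha, hμ.ge⟩
  have hint₀ : IntegrableOn (foxH A aStar B bStar) (Set.Icc 0 (rho A B)) :=
    integrableOn_foxH (P := (aStar, bStar)) hA hB hΔ hP₀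
  have hint : ∀ P ∈ paramSet p q, IntegrableOn (foxH A P.1 B P.2) (Set.Icc 0 (rho A B)) :=
    fun _ hP => integrableOn_foxH hA hB hΔ (paramSet_subset hP)
  refine ⟨hint, hint₀, fun η hη hηρ => ?_⟩
  have hlim : ∀ f : ℝ → ℝ, ContinuousOn f (Set.Icc η (rho A B)) →
      Tendsto (fun P : (Fin p → ℝ) × (Fin q → ℝ) =>
        ∫ x in Set.Icc η (rho A B), f x * foxH A P.1 B P.2 x) (𝓝[paramSet p q] (aStar, bStar))
        (𝓝 ((∫ x in Set.Icc η (rho A B), f x * foxH A aStar B bStar x)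
          + nu A aStar B bStar * (rho A B * f (rho A B)))) :=
    fun _ hf => tendsto_setIntegral_mul_foxH hA hB hΔ hP₀ hμ hη hηρ hf
  constructor
  · intro f hf
    rw [integral_limitMeasure_restrict hint₀ hη hηρ.le hf]
    refine (hlim f hf).congr' ?_
    filter_upwards [self_mem_nhdsWithin] with P hP
    exact (integral_foxMeasure_restrict (hint P hP) hη hf).2.symm
  · intro f hf
    have h := (hlim f hf).sub_const (nu A aStar B bStar * rho A B * f (rho A B))
    rwa [← mul_assoc, add_sub_cancel_right] at h
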